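/- Let $\mathcal X,\mathcal Y$ be countably infinite sets with their discrete $\sigma$-algebras and let $\pi=\pi_{XY}$ be a probability distribution on $\mathcal X\times\mathcal Y$. All logarithms are natural, $D(\cdot\|\cdot)$ is relative entropy and $I(\cdot\,;\cdot)$ is mutual information. For $n\ge 1$ and $R\ge 0$, a fixed-length $(n,R)$-code consists of a nonempty finite set $\mathcal M_n$ with $\frac1n\log|\mathcal M_n|\le R$ and of conditional distributions $P_{X^n|M_n}(\cdot|m)$ on $\mathcal X^n$ and $P_{Y^n|M_n}(\cdot|m)$ on $\mathcal Y^n$, $m\in\mathcal M_n$. It synthesizes the distribution $$P_{X^nY^n}(x^n,y^n)=\frac1{|\mathcal M_n|}\sum_{m\in\mathcal M_n}P_{X^n|M_n}(x^n|m)\,P_{Y^n|M_n}(y^n|m).$$ Let $T_1(\pi)$ be the infimum of all $R\ge 0$ for which there is a sequence of fixed-length $(n,R)$-codes, $n=1,2,\dots$, with $D(P_{X^nY^n}\|\pi^n)\to 0$ as $n\to\infty$, where $\pi^n$ is the $n$-fold product of $\pi$. Let $\widetilde T_1(\pi)$ be the infimum defined in the same way with $\frac1nD(P_{X^nY^n}\|\pi^n)\to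 0$ instead. For a probability distribution $\mu$ on a product of two alphabets put $$C_{\mathrm{Wyner}}(\mu)=\inf\{I(XY;W):\ P_WP_{X|W}P_{Y|W}\text{ with }P_{XY}=\mu\},$$ $$\widetilde C_{\mathrm{Wyner}}(\mu)=\lim_{\epsilon\downarrow0}\inf\{I(XY;W):\ P_WP_{X|W}P_{Y|W}\text{ with }D(P_{XY}\|\mu)\le\epsilon\},$$ where $W$ ranges over random variables with values in arbitrary measurable spaces and $P_WP_{X|W}P_{Y|W}$ denotes a joint law of $(W,X,Y)$ under which $X$ and $Y$ are conditionally independent given $W$. Assume that the Rényi entropy $H_\alpha(\pi)=\frac1{1-\alpha}\log\sum_{(x,y)\in\operatorname{supp}\pi}\pi(x,y)^\alpha$ is finite for some $\alpha\in[0,1)$. Then $$\widetilde T_1(\pi)=T_1(\pi)=C_{\mathrm{Wyner}}(\pi).$$ Moreover, $\widetilde C_{\mathrm{Wyner}}(\pi)=C_{\mathrm{Wyner}}(\pi)$ and, for every labelling of $\mathcal X$ and of $\mathcal Y$ by the integers (that is, for all bijections $\mathcal X\to\mathbb Z$ and $\mathcal Y\to\mathbb Z$, through which we regard both alphabets as $\mathbb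 Z$), $$C_{\mathrm{Wyner}}(\pi)=\lim_{k\to\infty}C_{\mathrm{Wyner}}\big(\pi^{(k)}\big)=\lim_{k\to\infty}C_{\mathrm{Wyner}}\big(\pi_{[X]_k[Y]_k}\big).$$ Here $\pi^{(k)}(x,y)=\pi(x,y)\,1\{(x,y)\in[-k,k]^2\}/\pi([-k,k]^2)$, which is defined for all large $k$, and $\pi_{[X]_k[Y]_k}$ is the law of $([X]_k,[Y]_k)$ for $(X,Y)\sim\pi$, where $[z]_k=z$ if $|z|\le k$ and $[z]_k=k+1$ otherwise. -/

import Mathlib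

open MeasureTheory ProbabilityTheory InformationTheory Filter Topology
open scoped ENNReal NNReal

noncomputable section

namespace CommonInfo

/-- Mutual information `I(U;V) = D(P_{UV} ‖ P_U P_V)` of a joint law; it is `⊤` unless
`P_{UV} ≪ P_U P_V` and the log-density is `P_{UV}`-integrable. -/
def mutualInfo {U V : Type*} [MeasurableSpace U] [MeasurableSpace V]
    (μ : Measure (U × V)) : ℝ≥0∞ :=
  klDiv μ (μ.fst.prod μ.snd)

/-- Rényi entropy of order `α ∈ [0,1)` of a discrete law:
`H_α(μ) = (1 - α)⁻¹ log ∑_{x ∈ supp μ} μ(x)^α`, with value `⊤` if the sum diverges. -/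
def renyiEntropy {Ω : Type*} [MeasurableSpace Ω] (α : ℝ) (μ : Measure Ω) : EReal :=
  (((1 - α)⁻¹ : ℝ) : EReal) * ENNReal.log (∑' x : {x : Ω // μ {x} ≠ 0}, μ {x.1} ^ α)

/-- A distribution of the form `P_W P_{X|W} P_{Y|W}`, with `W` in an arbitrary measurable space. -/
structure MarkovTriple (𝒳 𝒴 : Type*) [MeasurableSpace 𝒳] [MeasurableSpace 𝒴] where
  W : Type
  instW : MeasurableSpace W
  PW : ProbabilityMeasure W
  PX : Kernel W 𝒳
  PY : Kernel W 𝒴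
  markovX : IsMarkovKernel PX
  markovY : IsMarkovKernel PY

attribute [instance] MarkovTriple.instW MarkovTriple.markovX MarkovTriple.markovY

namespace MarkovTriple

variable {𝒳 𝒴 : Type*} [MeasurableSpace 𝒳] [MeasurableSpace 𝒴]

/-- The joint law of `(W, (X, Y))`; `X` and `Y` are conditionally independent given `W`. -/
def joint (P : MarkovTriple 𝒳 𝒴) : Measure (P.W × (𝒳 × 𝒴)) :=
  (P.PW : Measure P.W) ⊗ₘ (P.PX ×ₖ P.PY)

/-- The marginal law `P_{XY}`. -/
def lawXY (P : MarkovTriple 𝒳 𝒴) : Measure (𝒳 × 𝒴) := P.joint.snd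

/-- The mutual information `I(XY; W)`. -/
def info (P : MarkovTriple 𝒳 𝒴) : ℝ≥0∞ := mutualInfo P.joint

end MarkovTriple

/-- `C_Wyner(π) = inf { I(XY;W) : P_W P_{X|W} P_{Y|W} with P_{XY} = π }`. -/
def wynerCI {𝒳 𝒴 : Type*} [MeasurableSpace 𝒳] [MeasurableSpace 𝒴]
    (π : Measure (𝒳 × 𝒴)) : ℝ≥0∞ :=
  ⨅ (P : MarkovTriple 𝒳 𝒴) (_ : P.lawXY = π), P.info

/-- `inf { I(XY;W) : P_W P_{X|W} P_{Y|W} with D(P_{XY} ‖ π) ≤ ε }`. -/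
def relaxedWynerCI {𝒳 𝒴 : Type*} [MeasurableSpace 𝒳] [MeasurableSpace 𝒴]
    (π : Measure (𝒳 × 𝒴)) (ε : ℝ≥0∞) : ℝ≥0∞ :=
  ⨅ (P : MarkovTriple 𝒳 𝒴) (_ : klDiv P.lawXY π ≤ ε), P.info

/-- The `n`-fold product `π^n`, as a law of `(X^n, Y^n)`. -/
def iidLaw {𝒳 𝒴 : Type*} [MeasurableSpace 𝒳] [MeasurableSpace 𝒴]
    (π : Measure (𝒳 × 𝒴)) (n : ℕ) : Measure ((Fin n → 𝒳) × (Fin n → 𝒴)) :=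
  (Measure.pi fun _ : Fin n => π).map fun z => (fun i => (z i).1, fun i => (z i).2)

/-- A fixed-length `(n, R)`-code: a nonempty finite message set of size at most `e^{nR}` and
two random mappings from it to `𝒳^n` and `𝒴^n`. -/
structure FixedLengthCode (𝒳 𝒴 : Type*) [MeasurableSpace 𝒳] [MeasurableSpace 𝒴]
    (n : ℕ) (R : ℝ) where
  size : ℕ
  size_pos : 0 < size
  rate_le : Real.log size / n ≤ R
  PX : Fin size → ProbabilityMeasure (Fin n → 𝒳)
  PY : Fin size → ProbabilityMeasure (Fin n → 𝒴)

/-- The synthesized law `P_{X^n Y^n} = |M|⁻¹ ∑_m P_{X^n|M=m} P_{Y^n|M=m}`. -/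
def FixedLengthCode.law {𝒳 𝒴 : Type*} [MeasurableSpace 𝒳] [MeasurableSpace 𝒴]
    {n : ℕ} {R : ℝ} (c : FixedLengthCode 𝒳 𝒴 n R) :
    Measure ((Fin n → 𝒳) × (Fin n → 𝒴)) :=
  (c.size : ℝ≥0∞)⁻¹ • ∑ m, (c.PX m : Measure (Fin n → 𝒳)).prod (c.PY m : Measure (Fin n → 𝒴))

/-- The unnormalized common information `T₁(π)` of order one. -/
def T1 {𝒳 𝒴 : Type*} [MeasurableSpace 𝒳] [MeasurableSpace 𝒴]
    (π : Measure (𝒳 × 𝒴)) : ℝ≥0∞ :=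
  ⨅ (R : ℝ≥0) (_ : ∃ c : (n : ℕ) → FixedLengthCode 𝒳 𝒴 n R,
    Tendsto (fun n => klDiv (c n).law (iidLaw π n)) atTop (𝓝 0)), (R : ℝ≥0∞)

/-- The normalized common information `T̃₁(π)` of order one. -/
def normalizedT1 {𝒳 𝒴 : Type*} [MeasurableSpace 𝒳] [MeasurableSpace 𝒴]
    (π : Measure (𝒳 × 𝒴)) : ℝ≥0∞ :=
  ⨅ (R : ℝ≥0) (_ : ∃ c : (n : ℕ) → FixedLengthCode 𝒳 𝒴 n R,
    Tendsto (fun n => klDiv (c n).law (iidLaw π n) / (n : ℝ≥0∞)) atTop (𝓝 0)), (R : ℝ≥0∞)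

/-- The truncation `[z]_k`: `z` if `|z| ≤ k`, and `k + 1` otherwise. -/
def trunc (k : ℕ) (z : ℤ) : ℤ := if |z| ≤ (k : ℤ) then z else (k : ℤ) + 1

/-- The law `π` conditioned on `(X, Y) ∈ [-k, k]²`, the alphabets being labelled by `ℤ`. -/
def condTrunc {𝒳 𝒴 : Type*} [MeasurableSpace 𝒳] [MeasurableSpace 𝒴]
    (e : 𝒳 ≃ ℤ) (f : 𝒴 ≃ ℤ) (π : Measure (𝒳 × 𝒴)) (k : ℕ) : Measure (𝒳 × 𝒴) :=
  ProbabilityTheory.cond π {p | |e p.1| ≤ (k : ℤ) ∧ |f p.2| ≤ (k : ℤ)}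

/-- The law of `([X]_k, [Y]_k)`, the alphabets being labelled by `ℤ`. -/
def mapTrunc {𝒳 𝒴 : Type*} [MeasurableSpace 𝒳] [MeasurableSpace 𝒴]
    (e : 𝒳 ≃ ℤ) (f : 𝒴 ≃ ℤ) (π : Measure (𝒳 × 𝒴)) (k : ℕ) : Measure (ℤ × ℤ) :=
  π.map fun p => (trunc k (e p.1), trunc k (f p.2))

end CommonInfo

end

-- The equalities come from the cycle `wynerCI π` ≤ `normalizedT1 π` ≤ `T1 π` ≤ `wynerCI π`. The
-- Rényi hypothesis is used only through a finite negative moment E π(X,Y)^(-s) with 0 < s ≤ 1. This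
-- moment gives finite Shannon entropy, and for every triple with law π a finite moment B(s) = E
-- exp(s i(W;XY)) of the information density, because a conditional probability divided by π(z) is
-- at most 1/π(z).
--
-- Continuity rests on two operations on triples. Conditioning on a rectangle R keeps X and Y
-- conditionally independent and multiplies the information by at most 1/P(R)
-- (`exists_markovTriple_cond`). If π = c P_XY + r, the triple can be completed to law π by
-- generating r with W = (X,Y), at the cost log(1/c) + ∫ -log π dr (`exists_markovTriple_add`).
-- Finite entropy makes this cost vanish when c → 1 and r ≤ π vanishes in mass. This gives both
-- truncation limits. A small divergence from π brings the point masses close to those of π on any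
-- finite box, so conditioning on the box and then completing gives the limit of `relaxedWynerCI`.
--
-- The converse uses a Lagrangian. If K ≤ I(XY;W) + (1+l) D(P_XY‖π) for all triples, then splitting
-- off one letter at a time, with the past letters absorbed into W, gives nK ≤ log|M| + (1+l)
-- D(P_{X^nY^n}‖π^n) for every code (`nsmul_le_of_system`, `nsmul_le_of_code`). Only sums of
-- nonnegative terms occur, so no entropy has to be subtracted. A large l turns this into
-- `relaxedWynerCI π ε` ≤ R for every ε > 0.
--
-- Achievability is random coding. With M independent codewords the mean (1+s)-th moment of the
-- likelihood ratio is at most 1 + M^(-s) B(s)^n, and this moment dominates 1 + sD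
-- (`exists_codebook`). Since (B(s) - 1)/s decreases to I(XY;W) as s ↓ 0, every rate above the
-- information makes D decay exponentially.

universe u v

set_option linter.unusedSectionVars false

namespace CommonInfo

/-! ### Relative entropy on countable alphabets -/

section Discrete

variable {A B W : Type*} [MeasurableSpace A] [DiscreteMeasurableSpace A] [Countable A]
  [MeasurableSpace B] [DiscreteMeasurableSpace B] [Countable B] [MeasurableSpace W]

lemma ac_of_singleton {μ ν : Measure A} (h : ∀ a, ν {a} = 0 → μ {a} = 0) : μ ≪ ν := by
  intro s hs
  rw [← Set.biUnion_of_singleton s, measure_biUnion_null_iff s.to_countable]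
  intro a ha
  exact h a (measure_mono_null (Set.singleton_subset_iff.2 ha) hs)

lemma measurable_of_measurable_singleton {κ : W → Measure A} (h : ∀ a, Measurable fun w => κ w {a}) :
    Measurable κ := by
  refine Measure.measurable_of_measurable_coe _ fun s hs => ?_
  have : (fun w => κ w s) = fun w => ∑' a : s, κ w {a.1} := by
    ext w
    conv_lhs => rw [← Set.biUnion_of_singleton s]
    rw [measure_biUnion s.to_countable (fun a _ b _ hab => by simpa using hab)
      (fun a _ => measurableSet_singleton a)]
  rw [this]
  exact Measurable.tsum fun a => h a

/-- A family of measures on a countable set with measurable point masses is a kernel. -/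
noncomputable def kernelOfSingleton (κ : W → Measure A) (h : ∀ a, Measurable fun w => κ w {a}) :
    Kernel W A := ⟨κ, measurable_of_measurable_singleton h⟩

/-- The density `dμ/dν` of measures on a countable set. -/
noncomputable def ratio (μ ν : Measure A) (a : A) : ℝ≥0∞ := μ {a} / ν {a}

lemma ratio_mul (μ ν : Measure A) [IsFiniteMeasure ν] (h : μ ≪ ν) (a : A) :
    ratio μ ν a * ν {a} = μ {a} :=
  ENNReal.div_mul_cancel' (fun h0 => h h0) (fun h1 => absurd h1 (measure_ne_top _ _))

lemma withDensity_ratio (μ ν : Measure A) [IsFiniteMeasure ν] (h : μ ≪ ν) :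
    ν.withDensity (ratio μ ν) = μ := by
  refine Measure.ext_of_singleton fun a => ?_
  rw [withDensity_apply _ (measurableSet_singleton a), lintegral_singleton, ratio_mul μ ν h]

lemma ratio_ne_top (μ ν : Measure A) [IsFiniteMeasure μ] [IsFiniteMeasure ν] {a : A}
    (h : ν {a} ≠ 0) : ratio μ ν a ≠ ∞ := ENNReal.div_ne_top (measure_ne_top _ _) h

lemma ae_measure_singleton_ne_zero (ν : Measure A) : ∀ᵐ a ∂ν, ν {a} ≠ 0 := by
  rw [ae_iff]
  simp only [not_not]
  rw [← Set.biUnion_of_singleton {a | ν {a} = 0}, measure_biUnion_null_iff (Set.to_countable _)]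
  exact fun a ha => ha

lemma lintegral_ratio_mul (μ ν : Measure A) [IsFiniteMeasure ν] (h : μ ≪ ν) (f : A → ℝ≥0∞) :
    ∫⁻ a, ratio μ ν a * f a ∂ν = ∫⁻ a, f a ∂μ := by
  conv_rhs => rw [← withDensity_ratio μ ν h]
  rw [lintegral_withDensity_eq_lintegral_mul _ .of_discrete .of_discrete]
  rfl

lemma lintegral_ratio (μ ν : Measure A) [IsFiniteMeasure ν] (h : μ ≪ ν) :
    ∫⁻ a, ratio μ ν a ∂ν = μ Set.univ := by
  simpa using lintegral_ratio_mul μ ν h 1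

lemma klDiv_withDensity {Ω : Type*} [MeasurableSpace Ω] (ν : Measure Ω) [IsFiniteMeasure ν]
    {f : Ω → ℝ≥0∞} (hf : Measurable f) [IsFiniteMeasure (ν.withDensity f)] :
    klDiv (ν.withDensity f) ν = ∫⁻ x, ENNReal.ofReal (klFun (f x).toReal) ∂ν := by
  rw [klDiv_eq_lintegral_klFun_of_ac (withDensity_absolutelyContinuous _ _)]
  refine lintegral_congr_ae ?_
  filter_upwards [Measure.rnDeriv_withDensity ν hf] with x hx
  rw [hx]

lemma klDiv_eq_lintegral_ratio (μ ν : Measure A) [IsFiniteMeasure μ] [IsFiniteMeasure ν]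
    (h : μ ≪ ν) : klDiv μ ν = ∫⁻ a, ENNReal.ofReal (klFun (ratio μ ν a).toReal) ∂ν := by
  have hm := withDensity_ratio μ ν h
  have : IsFiniteMeasure (ν.withDensity (ratio μ ν)) := by rw [hm]; infer_instance
  rw [← klDiv_withDensity ν .of_discrete, hm]

lemma klDiv_map_equiv {Ω Ω' : Type*} [MeasurableSpace Ω] [MeasurableSpace Ω'] (e : Ω ≃ᵐ Ω')
    (μ ν : Measure Ω) [IsFiniteMeasure μ] [IsFiniteMeasure ν] :
    klDiv (μ.map e) (ν.map e) = klDiv μ ν := by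
  refine le_antisymm (klDiv_map_le _ _ e.measurable) ?_
  have := klDiv_map_le (μ.map e) (ν.map e) e.symm.measurable
  simpa [Measure.map_map e.symm.measurable e.measurable] using this

lemma ae_ac_of_singleton {μ : Measure W} {κ : W → Measure A} {q : Measure A}
    (h : ∀ a, q {a} = 0 → ∀ᵐ w ∂μ, κ w {a} = 0) : ∀ᵐ w ∂μ, κ w ≪ q := by
  have : ∀ᵐ w ∂μ, ∀ a, q {a} = 0 → κ w {a} = 0 := by
    rw [ae_all_iff]
    intro a
    by_cases ha : q {a} = 0
    · filter_upwards [h a ha] with w hw _ using hw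
    · exact Eventually.of_forall fun w h' => absurd h' ha
  filter_upwards [this] with w hw using ac_of_singleton hw

lemma measurable_ratio_kernel (κ : Kernel W A) (q : Measure A) :
    Measurable fun p : W × A => ratio (κ p.1) q p.2 := by
  refine measurable_from_prod_countable_left fun a => ?_
  exact (κ.measurable_coe (measurableSet_singleton a)).div_const (q {a})

lemma compProd_eq_withDensity (μ : Measure W) [IsProbabilityMeasure μ] (κ : Kernel W A)
    [IsMarkovKernel κ] (q : Measure A) [IsProbabilityMeasure q] (h : ∀ᵐ w ∂μ, κ w ≪ q) :
    μ ⊗ₘ κ = (μ.prod q).withDensity fun p => ratio (κ p.1) q p.2 := by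
  have hm := measurable_ratio_kernel κ q
  ext s hs
  rw [Measure.compProd_apply hs, withDensity_apply _ hs, ← lintegral_indicator hs,
    lintegral_prod _ (hm.indicator hs).aemeasurable]
  refine lintegral_congr_ae ?_
  filter_upwards [h] with w hw
  conv_lhs => rw [← withDensity_ratio (κ w) q hw]
  rw [withDensity_apply _ (measurable_prodMk_left hs), ← lintegral_indicator (measurable_prodMk_left hs)]
  rfl

lemma measurable_klDiv_kernel_aux (κ : Kernel W A) (q : Measure A) [SFinite q] :
    Measurable fun w => ∫⁻ a, ENNReal.ofReal (klFun (ratio (κ w) q a).toReal) ∂q :=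
  Measurable.lintegral_prod_right' (f := fun p : W × A =>
    ENNReal.ofReal (klFun (ratio (κ p.1) q p.2).toReal))
    (measurable_klFun.comp (measurable_ratio_kernel κ q).ennreal_toReal).ennreal_ofReal

lemma measurableSet_ac (κ : Kernel W A) (q : Measure A) : MeasurableSet {w | κ w ≪ q} := by
  have : {w | κ w ≪ q} = ⋂ a, {w | q {a} = 0 → κ w {a} = 0} := by
    ext w
    simp only [Set.mem_ofPred_eq, Set.mem_iInter]
    exact ⟨fun h a ha => h ha, ac_of_singleton⟩
  rw [this]
  refine MeasurableSet.iInter fun a => ?_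
  by_cases ha : q {a} = 0
  · simp only [ha, true_imp_iff]
    exact (κ.measurable_coe (measurableSet_singleton a)) (measurableSet_singleton 0)
  · simp [ha]

lemma measurable_klDiv_kernel (κ : Kernel W A) [IsMarkovKernel κ] (q : Measure A)
    [IsProbabilityMeasure q] : Measurable fun w => klDiv (κ w) q := by
  classical
  have : (fun w => klDiv (κ w) q) = fun w => if κ w ≪ q then
      ∫⁻ a, ENNReal.ofReal (klFun (ratio (κ w) q a).toReal) ∂q else ∞ := by
    ext w
    split_ifs with h
    · exact klDiv_eq_lintegral_ratio _ _ h
    · exact klDiv_of_not_ac h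
  rw [this]
  exact Measurable.ite (measurableSet_ac κ q) (measurable_klDiv_kernel_aux κ q) measurable_const

/-- Relative entropy to a product law, as an average of conditional relative entropies. -/
lemma klDiv_compProd_prod (μ : Measure W) [IsProbabilityMeasure μ] (κ : Kernel W A)
    [IsMarkovKernel κ] (q : Measure A) [IsProbabilityMeasure q] :
    klDiv (μ ⊗ₘ κ) (μ.prod q) = ∫⁻ w, klDiv (κ w) q ∂μ := by
  by_cases h : ∀ᵐ w ∂μ, κ w ≪ q
  · have hm := measurable_ratio_kernel κ q
    have he := compProd_eq_withDensity μ κ q h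
    have : IsFiniteMeasure ((μ.prod q).withDensity fun p => ratio (κ p.1) q p.2) := by
      rw [← he]; infer_instance
    have hk : Measurable fun p : W × A => ENNReal.ofReal (klFun (ratio (κ p.1) q p.2).toReal) :=
      (measurable_klFun.comp hm.ennreal_toReal).ennreal_ofReal
    rw [he, klDiv_withDensity _ hm, lintegral_prod _ hk.aemeasurable]
    refine lintegral_congr_ae ?_
    filter_upwards [h] with w hw
    rw [klDiv_eq_lintegral_ratio _ _ hw]
  -- Without almost sure absolute continuity both sides are infinite.
  · have h1 : klDiv (μ ⊗ₘ κ) (μ.prod q) = ∞ := by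
      by_contra h2
      have hac := (klDiv_ne_top_iff.1 h2).1
      refine h (ae_ac_of_singleton fun a ha => ?_)
      have h3 : (μ.prod q) (Set.univ ×ˢ {a}) = 0 := by simp [ha]
      have h4 := hac h3
      rw [Measure.compProd_apply (MeasurableSet.univ.prod (measurableSet_singleton a)),
        lintegral_eq_zero_iff (Kernel.measurable_kernel_prodMk_left
          (MeasurableSet.univ.prod (measurableSet_singleton a)))] at h4
      filter_upwards [h4] with w hw
      simpa using hw
    rw [h1]
    symm
    by_contra h2
    have := ae_lt_top (measurable_klDiv_kernel κ q) h2
    exact h (this.mono fun w hw => (klDiv_ne_top_iff.1 hw.ne).1)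

/-- Compensation identity. -/
lemma lintegral_klDiv_eq_add [StandardBorelSpace W] (μ : Measure W) [IsProbabilityMeasure μ]
    (κ : Kernel W A) [IsMarkovKernel κ] (q : Measure A) [IsProbabilityMeasure q] :
    ∫⁻ w, klDiv (κ w) q ∂μ = ∫⁻ w, klDiv (κ w) (κ ∘ₘ μ) ∂μ + klDiv (κ ∘ₘ μ) q := by
  have : Nonempty W := μ.nonempty_of_neZero
  rw [← klDiv_compProd_prod, ← klDiv_compProd_prod]
  -- The chain rule splits off the first coordinate, so the coordinates are exchanged and the joint
  -- law is disintegrated over its `A`-marginal. The reference measures for `q` and for the true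
  -- marginal then differ only in that first factor.
  have hs : ∀ r : Measure A, IsProbabilityMeasure r → klDiv (μ ⊗ₘ κ) (μ.prod r) =
      klDiv ((μ ⊗ₘ κ).map MeasurableEquiv.prodComm) (r.prod μ) := by
    intro r hr
    rw [← klDiv_map_equiv MeasurableEquiv.prodComm]
    congr 1
    exact Measure.prod_swap
  rw [hs q inferInstance, hs _ inferInstance]
  set ρ := (μ ⊗ₘ κ).map MeasurableEquiv.prodComm with hρ
  have : IsProbabilityMeasure ρ := Measure.isProbabilityMeasure_map (by fun_prop)
  have hfst : ρ.fst = κ ∘ₘ μ := by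
    rw [← Measure.snd_compProd, Measure.fst, Measure.snd, hρ,
      Measure.map_map measurable_fst (by fun_prop)]
    rfl
  have hd := ρ.disintegrate ρ.condKernel
  rw [hfst] at hd
  rw [← hd, ← Measure.compProd_const, ← Measure.compProd_const, klDiv_compProd_eq_add, add_comm]

/-- If `μ ≤ C π` then replacing `μ` by `π` costs at most `log C` in relative entropy. -/
lemma klDiv_le_add_log (κ μ π : Measure A) [IsProbabilityMeasure κ] [IsProbabilityMeasure μ]
    [IsProbabilityMeasure π] (C : ℝ) (hC : 1 ≤ C) (h : ∀ a, μ {a} ≤ ENNReal.ofReal C * π {a}) :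
    klDiv κ π ≤ klDiv κ μ + ENNReal.ofReal (Real.log C) := by
  by_cases hκ : κ ≪ μ
  swap; · simp [hκ]
  have hμ : μ ≪ π := ac_of_singleton fun a ha => by simpa [ha] using h a
  rw [klDiv_eq_lintegral_ratio _ _ (hκ.trans hμ), klDiv_eq_lintegral_ratio _ _ hκ]
  -- With u = dμ/dπ ≤ C and t = dκ/dμ, klFun(tu) = u klFun(t) + tu log u + 1 - u. The term u is
  -- moved to the left to avoid subtraction; it and the constant 1 both integrate to 1 and cancel at
  -- the end.
  have key : ∫⁻ a, (ENNReal.ofReal (klFun (ratio κ π a).toReal) + ratio μ π a) ∂π ≤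
      ∫⁻ a, (ratio μ π a * ENNReal.ofReal (klFun (ratio κ μ a).toReal)
        + ratio κ π a * ENNReal.ofReal (Real.log C) + 1) ∂π := by
    refine lintegral_mono_ae ?_
    filter_upwards [ae_measure_singleton_ne_zero π] with a ha
    obtain ⟨u, hu⟩ : ∃ u : ℝ≥0, (u : ℝ≥0∞) = ratio μ π a :=
      ⟨_, ENNReal.coe_toNNReal (ratio_ne_top μ π ha)⟩
    have huC : (u : ℝ) ≤ C := by
      have : (u : ℝ≥0∞) ≤ ENNReal.ofReal C := by
        rw [hu]; exact ENNReal.div_le_of_le_mul (h a)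
      rw [← ENNReal.ofReal_coe_nnreal] at this
      exact (ENNReal.ofReal_le_ofReal_iff (by linarith)).1 this
    by_cases hm : μ {a} = 0
    · have h1 : ratio μ π a = 0 := by simp [ratio, hm]
      have h2 : ratio κ π a = 0 := by simp [ratio, hκ hm]
      simp [h1, h2, klFun_zero]
    · obtain ⟨t, ht⟩ : ∃ t : ℝ≥0, (t : ℝ≥0∞) = ratio κ μ a :=
        ⟨_, ENNReal.coe_toNNReal (ratio_ne_top κ μ hm)⟩
      have htu : ratio κ π a = ((t * u : ℝ≥0) : ℝ≥0∞) := by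
        rw [ENNReal.coe_mul, ht, hu, ratio, ratio, ratio, ← mul_div_assoc,
          ENNReal.div_mul_cancel hm (measure_ne_top _ _)]
      have hu0 : 0 < (u : ℝ) := by
        have : (u : ℝ≥0∞) ≠ 0 := by
          rw [hu]; exact (ENNReal.div_pos hm (measure_ne_top _ _)).ne'
        exact_mod_cast pos_iff_ne_zero.2 this
      rw [htu, ← hu, ← ht]
      simp only [ENNReal.coe_toReal]
      simp only [← ENNReal.ofReal_coe_nnreal, ← ENNReal.ofReal_one]
      have hk1 := klFun_nonneg (x := (t : ℝ)) (NNReal.coe_nonneg t)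
      have hk2 := klFun_nonneg (x := ((t * u : ℝ≥0) : ℝ)) (t * u).2
      have hl : 0 ≤ Real.log C := Real.log_nonneg hC
      rw [← ENNReal.ofReal_mul (NNReal.coe_nonneg u), ← ENNReal.ofReal_mul (NNReal.coe_nonneg (t * u)), ← ENNReal.ofReal_add hk2 (NNReal.coe_nonneg u),
        ← ENNReal.ofReal_add (mul_nonneg (NNReal.coe_nonneg u) hk1) (mul_nonneg (NNReal.coe_nonneg (t * u)) hl),
        ← ENNReal.ofReal_add (by positivity) zero_le_one]
      refine ENNReal.ofReal_le_ofReal ?_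
      have hlog : Real.log u ≤ Real.log C := Real.log_le_log hu0 huC
      have hid : klFun ((t * u : ℝ≥0) : ℝ) = u * klFun t + t * u * Real.log u + 1 - u := by
        rw [NNReal.coe_mul, klFun_apply, klFun_apply]
        rcases eq_or_ne (t : ℝ) 0 with h0 | h0
        · simp [h0]
        · rw [Real.log_mul h0 hu0.ne']; ring
      rw [hid, NNReal.coe_mul]
      have : (t : ℝ) * u * Real.log u ≤ t * u * Real.log C :=
        mul_le_mul_of_nonneg_left hlog (by positivity)
      linarith
  rw [lintegral_add_left .of_discrete, lintegral_add_left .of_discrete,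
    lintegral_add_left .of_discrete, lintegral_ratio _ _ hμ, lintegral_ratio_mul _ _ hμ,
    lintegral_mul_const _ .of_discrete, lintegral_ratio _ _ (hκ.trans hμ)] at key
  simp only [measure_univ, one_mul, lintegral_const, mul_one] at key
  exact (ENNReal.add_le_add_iff_right ENNReal.one_ne_top).1 key

end Discrete

/-! ### Relative entropy under conditioning -/

section Conditioning

variable {A : Type*} [MeasurableSpace A] [DiscreteMeasurableSpace A] [Countable A]

/-- Conditioning on an event `R` gains at most a factor `κ(R)` in relative entropy. -/
lemma measure_mul_klDiv_cond_le (κ μ : Measure A) [IsProbabilityMeasure κ] [IsProbabilityMeasure μ]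
    (R : Set A) (hR : κ R ≠ 0) : κ R * klDiv κ[|R] μ[|R] ≤ klDiv κ μ := by
  by_cases hκ : κ ≪ μ
  swap; · simp [hκ]
  have hp : μ R ≠ 0 := fun h => hR (hκ h)
  have hRm : MeasurableSet R := .of_discrete
  have := cond_isProbabilityMeasure hR
  have := cond_isProbabilityMeasure hp
  have hac : κ[|R] ≪ μ[|R] := by
    refine ac_of_singleton fun z hz => ?_
    rw [cond_apply hRm] at hz ⊢
    have : μ (R ∩ {z}) = 0 := by
      rcases mul_eq_zero.1 hz with h | h
      · exact absurd h (ENNReal.inv_ne_zero.2 (measure_ne_top _ _))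
      · exact h
    rw [hκ this, mul_zero]
  obtain ⟨g, hg⟩ : ∃ g : ℝ≥0, (g : ℝ≥0∞) = κ R := ⟨_, ENNReal.coe_toNNReal (measure_ne_top _ _)⟩
  obtain ⟨p, hpp⟩ : ∃ p : ℝ≥0, (p : ℝ≥0∞) = μ R := ⟨_, ENNReal.coe_toNNReal (measure_ne_top _ _)⟩
  have hg0 : g ≠ 0 := by rintro rfl; exact hR (by simpa using hg.symm)
  have hp0 : p ≠ 0 := by rintro rfl; exact hp (by simpa using hpp.symm)
  have hgpos : (0 : ℝ) < g := by exact_mod_cast pos_iff_ne_zero.2 hg0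
  have hppos : (0 : ℝ) < p := by exact_mod_cast pos_iff_ne_zero.2 hp0
  rw [klDiv_eq_lintegral_ratio _ _ hac, klDiv_eq_lintegral_ratio _ _ hκ]
  refine le_trans ?_ (setLIntegral_le_lintegral R _)
  have e1 : κ R * ∫⁻ a, ENNReal.ofReal (klFun (ratio κ[|R] μ[|R] a).toReal) ∂μ[|R] =
      ∫⁻ a in R, ((g / p : ℝ≥0) : ℝ≥0∞) *
        ENNReal.ofReal (klFun (ratio κ[|R] μ[|R] a).toReal) ∂μ := by
    rw [ProbabilityTheory.cond, lintegral_smul_measure, lintegral_const_mul _ .of_discrete,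
      smul_eq_mul, ← mul_assoc, ← hg, ← hpp, ENNReal.coe_div hp0, div_eq_mul_inv]
  rw [e1]
  -- With t = dκ/dμ, g = κ(R), p = μ(R), the conditional density is tp/g, and right minus left
  -- equals t(log(g/p) - 1 + p/g) ≥ 0. The auxiliary terms integrate to g + p over R on either side,
  -- hence cancel.
  have key : ∫⁻ a in R, (((g / p : ℝ≥0) : ℝ≥0∞) *
        ENNReal.ofReal (klFun (ratio κ[|R] μ[|R] a).toReal) + ratio κ μ a + 1) ∂μ ≤
      ∫⁻ a in R, (ENNReal.ofReal (klFun (ratio κ μ a).toReal) + ((g / p : ℝ≥0) : ℝ≥0∞) +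
        ((p / g : ℝ≥0) : ℝ≥0∞) * ratio κ μ a) ∂μ := by
    rw [← lintegral_indicator hRm, ← lintegral_indicator hRm]
    refine lintegral_mono_ae ?_
    filter_upwards [ae_measure_singleton_ne_zero μ] with a ha
    by_cases haR : a ∈ R
    swap; · simp [haR]
    rw [Set.indicator_of_mem haR, Set.indicator_of_mem haR]
    obtain ⟨t, ht⟩ : ∃ t : ℝ≥0, (t : ℝ≥0∞) = ratio κ μ a :=
      ⟨_, ENNReal.coe_toNNReal (ratio_ne_top κ μ ha)⟩
    have hi : R ∩ {a} = {a} := Set.inter_eq_right.2 (Set.singleton_subset_iff.2 haR)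
    have ht' : ratio κ[|R] μ[|R] a = ((t * p / g : ℝ≥0) : ℝ≥0∞) := by
      rw [ratio, cond_apply hRm, cond_apply hRm, hi, ENNReal.coe_div hg0, ENNReal.coe_mul, ht,
        ← hg, ← hpp, ratio, div_eq_mul_inv, div_eq_mul_inv, div_eq_mul_inv,
        ENNReal.mul_inv (Or.inl (ENNReal.inv_ne_zero.2 ENNReal.coe_ne_top))
          (Or.inr ha), inv_inv]
      ring
    rw [ht', ← ht]
    simp only [ENNReal.coe_toReal]
    simp only [← ENNReal.ofReal_coe_nnreal, ← ENNReal.ofReal_one]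
    have hk1 := klFun_nonneg (x := (t : ℝ)) (NNReal.coe_nonneg t)
    have hk2 := klFun_nonneg (x := ((t * p / g : ℝ≥0) : ℝ)) (NNReal.coe_nonneg _)
    rw [← ENNReal.ofReal_mul (NNReal.coe_nonneg _), ← ENNReal.ofReal_mul (NNReal.coe_nonneg _),
      ← ENNReal.ofReal_add (by positivity) (NNReal.coe_nonneg _),
      ← ENNReal.ofReal_add (by positivity) zero_le_one,
      ← ENNReal.ofReal_add hk1 (NNReal.coe_nonneg _),
      ← ENNReal.ofReal_add (by positivity) (by positivity)]
    refine ENNReal.ofReal_le_ofReal ?_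
    rw [klFun_apply, klFun_apply]
    push_cast
    have hlog : 1 - (p : ℝ) / g ≤ Real.log (g / p) := by
      have := Real.one_sub_inv_le_log_of_pos (div_pos hgpos hppos)
      rwa [inv_div] at this
    have hlog' := mul_le_mul_of_nonneg_left hlog (NNReal.coe_nonneg t)
    rcases eq_or_ne (t : ℝ) 0 with h0 | h0
    · simp [h0]; linarith
    · rw [mul_div_assoc, Real.log_mul h0 (by positivity), ← inv_div (g : ℝ) p, Real.log_inv]
      have e : (g : ℝ) / p * (t * (g / p : ℝ)⁻¹ * (Real.log t + -Real.log (g / p)) + 1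
          - t * (g / p : ℝ)⁻¹) = t * (Real.log t - Real.log (g / p)) + g / p - t := by
        field_simp
        ring
      rw [e, inv_div]
      linarith
  rw [lintegral_add_left .of_discrete, lintegral_add_left .of_discrete,
    lintegral_add_left .of_discrete, lintegral_add_left .of_discrete,
    lintegral_const_mul _ .of_discrete (f := fun a => ratio κ μ a)] at key
  have hr : ∫⁻ a in R, ratio κ μ a ∂μ = g := by
    rw [← withDensity_apply _ hRm, withDensity_ratio _ _ hκ, hg]
  rw [hr] at key
  simp only [lintegral_const, Measure.restrict_apply_univ, one_mul, ← hpp, ← ENNReal.coe_mul,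
    div_mul_cancel₀ _ hp0, div_mul_cancel₀ _ hg0, add_assoc] at key
  rwa [← add_assoc, ← add_assoc, ENNReal.add_le_add_iff_right ENNReal.coe_ne_top,
    ENNReal.add_le_add_iff_right ENNReal.coe_ne_top] at key

end Conditioning

/-! ### Triples: channel form and post-processing -/

namespace MarkovTriple

section General

variable {𝒳 𝒴 : Type*} [MeasurableSpace 𝒳] [MeasurableSpace 𝒴]

/-- The conditional law of `(X, Y)` given `W`. -/
noncomputable def channel (P : MarkovTriple 𝒳 𝒴) : Kernel P.W (𝒳 × 𝒴) := P.PX ×ₖ P.PY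

instance (P : MarkovTriple 𝒳 𝒴) : IsMarkovKernel P.channel := by
  unfold channel; infer_instance

lemma channel_apply (P : MarkovTriple 𝒳 𝒴) (w : P.W) : P.channel w = (P.PX w).prod (P.PY w) :=
  Kernel.prod_apply _ _ _

lemma lawXY_eq (P : MarkovTriple 𝒳 𝒴) : P.lawXY = P.channel ∘ₘ (P.PW : Measure P.W) :=
  Measure.snd_compProd _ _

instance (P : MarkovTriple 𝒳 𝒴) : IsProbabilityMeasure P.lawXY := by
  rw [lawXY_eq]; infer_instance

lemma lawXY_apply (P : MarkovTriple 𝒳 𝒴) {s : Set (𝒳 × 𝒴)} (hs : MeasurableSet s) :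
    P.lawXY s = ∫⁻ w, P.channel w s ∂P.PW := by
  rw [lawXY_eq, Measure.bind_apply hs P.channel.aemeasurable]

end General

section Discrete

variable {𝒳 𝒴 : Type*} [MeasurableSpace 𝒳] [DiscreteMeasurableSpace 𝒳] [Countable 𝒳]
  [MeasurableSpace 𝒴] [DiscreteMeasurableSpace 𝒴] [Countable 𝒴]

lemma info_eq (P : MarkovTriple 𝒳 𝒴) :
    P.info = ∫⁻ w, klDiv (P.channel w) P.lawXY ∂P.PW := by
  have h1 : P.joint.fst = P.PW := Measure.fst_compProd _ _
  rw [info, mutualInfo, h1, ← klDiv_compProd_prod]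
  rfl

variable {𝒳' 𝒴' : Type*} [MeasurableSpace 𝒳'] [DiscreteMeasurableSpace 𝒳'] [Countable 𝒳']
  [MeasurableSpace 𝒴'] [DiscreteMeasurableSpace 𝒴'] [Countable 𝒴']

/-- The triple with given law of `W` and channels. -/
lemma exists_of_kernels {W : Type} [MeasurableSpace W] (PW : Measure W) [IsProbabilityMeasure PW]
    (KX : Kernel W 𝒳) (KY : Kernel W 𝒴) [IsMarkovKernel KX] [IsMarkovKernel KY] :
    ∃ P : MarkovTriple 𝒳 𝒴, P.lawXY = (KX ×ₖ KY) ∘ₘ PW ∧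
      P.info = ∫⁻ w, klDiv ((KX ×ₖ KY) w) ((KX ×ₖ KY) ∘ₘ PW) ∂PW := by
  let P : MarkovTriple 𝒳 𝒴 :=
    { W := W, instW := inferInstance, PW := ⟨PW, inferInstance⟩, PX := KX, PY := KY,
      markovX := inferInstance, markovY := inferInstance }
  have h : P.lawXY = (KX ×ₖ KY) ∘ₘ PW := P.lawXY_eq
  refine ⟨P, h, ?_⟩
  rw [P.info_eq, h]
  rfl

/-- Post-processing of both outputs does not increase the information. -/
lemma exists_map (P : MarkovTriple 𝒳 𝒴) (g : 𝒳 → 𝒳') (h : 𝒴 → 𝒴') :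
    ∃ P' : MarkovTriple 𝒳' 𝒴', P'.lawXY = P.lawXY.map (Prod.map g h) ∧ P'.info ≤ P.info := by
  have : IsMarkovKernel (P.PX.map g) := Kernel.IsMarkovKernel.map _ .of_discrete
  have : IsMarkovKernel (P.PY.map h) := Kernel.IsMarkovKernel.map _ .of_discrete
  obtain ⟨P', h1, h2⟩ := exists_of_kernels (P.PW : Measure P.W) (P.PX.map g) (P.PY.map h)
  have hch : ∀ w, (P.PX.map g ×ₖ P.PY.map h) w = (P.channel w).map (Prod.map g h) := by
    intro w
    rw [channel_apply, Kernel.prod_apply, ← Measure.map_prod_map _ _ .of_discrete .of_discrete,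
      Kernel.map_apply _ .of_discrete, Kernel.map_apply _ .of_discrete]
  have hlaw : P'.lawXY = P.lawXY.map (Prod.map g h) := by
    ext s hs
    rw [h1, Measure.bind_apply hs (Kernel.aemeasurable _), Measure.map_apply .of_discrete hs,
      lawXY_apply _ .of_discrete]
    refine lintegral_congr fun w => ?_
    rw [hch, Measure.map_apply .of_discrete hs]
  refine ⟨P', hlaw, ?_⟩
  rw [h2, info_eq, ← h1, hlaw]
  refine lintegral_mono fun w => ?_
  rw [hch]
  exact klDiv_map_le _ _ .of_discrete

end Discrete

end MarkovTriple

/-! ### Conditioning and completing a triple -/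

section Discrete

variable {𝒳 𝒴 : Type*} [MeasurableSpace 𝒳] [DiscreteMeasurableSpace 𝒳] [Countable 𝒳]
  [MeasurableSpace 𝒴] [DiscreteMeasurableSpace 𝒴] [Countable 𝒴]

/-- `μ` conditioned on `s`, or `μ` itself if `s` is a null set. -/
noncomputable def condOr {A : Type*} [MeasurableSpace A] (s : Set A) (μ : Measure A) : Measure A :=
  open Classical in if μ s = 0 then μ else μ[|s]

lemma isProbabilityMeasure_condOr {A : Type*} [MeasurableSpace A] (s : Set A) (μ : Measure A)
    [IsProbabilityMeasure μ] : IsProbabilityMeasure (condOr s μ) := by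
  rw [condOr]
  split_ifs with h
  · infer_instance
  · exact cond_isProbabilityMeasure h

lemma measurable_condOr {A W : Type*} [MeasurableSpace A] [DiscreteMeasurableSpace A]
    [MeasurableSpace W] (s : Set A) (κ : Kernel W A) (a : A) :
    Measurable fun w => condOr s (κ w) {a} := by
  classical
  have : (fun w => condOr s (κ w) {a}) = fun w => if κ w s = 0 then κ w {a} else
      (κ w s)⁻¹ * κ w (s ∩ {a}) := by
    ext w
    rw [condOr]
    split_ifs with h
    · rfl
    · rw [cond_apply .of_discrete]
  rw [this]
  have h1 := κ.measurable_coe (.of_discrete : MeasurableSet s)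
  exact Measurable.ite (h1 (measurableSet_singleton 0)) (κ.measurable_coe .of_discrete)
    (h1.inv.mul (κ.measurable_coe .of_discrete))

/-- The kernel conditioned on an event. -/
noncomputable def condKer {A W : Type*} [MeasurableSpace A] [DiscreteMeasurableSpace A] [Countable A]
    [MeasurableSpace W] (s : Set A) (κ : Kernel W A) : Kernel W A :=
  kernelOfSingleton (fun w => condOr s (κ w)) (measurable_condOr s κ)

instance {A W : Type*} [MeasurableSpace A] [DiscreteMeasurableSpace A] [Countable A]
    [MeasurableSpace W] (s : Set A) (κ : Kernel W A) [IsMarkovKernel κ] :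
    IsMarkovKernel (condKer s κ) := ⟨fun w => isProbabilityMeasure_condOr s (κ w)⟩

/-- Independence survives conditioning on a rectangle; this is why triples are conditioned on sets
`s ×ˢ t` only. -/
lemma prod_cond {μ : Measure 𝒳} {ν : Measure 𝒴} [IsProbabilityMeasure μ] [IsProbabilityMeasure ν]
    (s : Set 𝒳) (t : Set 𝒴) :
    μ[|s].prod ν[|t] = (μ.prod ν)[|s ×ˢ t] := by
  rw [ProbabilityTheory.cond, ProbabilityTheory.cond, ProbabilityTheory.cond,
    Measure.prod_smul_left, Measure.prod_smul_right, Measure.prod_restrict, smul_smul,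
    Measure.prod_prod, ENNReal.mul_inv (Or.inr (measure_ne_top _ _)) (Or.inl (measure_ne_top _ _))]

/-- Conditioning a triple on a rectangle. -/
lemma exists_markovTriple_cond (P : MarkovTriple 𝒳 𝒴) (s : Set 𝒳) (t : Set 𝒴)
    (h : P.lawXY (s ×ˢ t) ≠ 0) : ∃ P' : MarkovTriple 𝒳 𝒴, P'.lawXY = P.lawXY[|s ×ˢ t] ∧
      P.lawXY (s ×ˢ t) * P'.info ≤ P.info := by
  have hR : MeasurableSet (s ×ˢ t) := .of_discrete
  set p := P.lawXY (s ×ˢ t) with hp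
  have hpt : p ≠ ∞ := measure_ne_top _ _
  have hgm : Measurable fun w => P.channel w (s ×ˢ t) := P.channel.measurable_coe hR
  -- This is the posterior law of W given the rectangle, so that the conditioned channels average to
  -- the conditioned law. The default branch of `condOr` is harmless: values of w for which the
  -- rectangle is null get weight zero.
  set PW' : Measure P.W := p⁻¹ • (P.PW : Measure P.W).withDensity fun w => P.channel w (s ×ˢ t)
    with hPW'
  have hprob : IsProbabilityMeasure PW' := by
    constructor
    rw [hPW', Measure.smul_apply, withDensity_apply _ .univ, setLIntegral_univ,
      ← P.lawXY_apply hR, smul_eq_mul, ENNReal.inv_mul_cancel h hpt]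
  obtain ⟨P', h1, h2⟩ := MarkovTriple.exists_of_kernels PW' (condKer s P.PX) (condKer t P.PY)
  have hch : ∀ w : P.W, P.channel w (s ×ˢ t) ≠ 0 →
      (condKer s P.PX ×ₖ condKer t P.PY) w = (P.channel w)[|s ×ˢ t] := by
    intro w hw
    rw [P.channel_apply] at hw ⊢
    rw [Measure.prod_prod] at hw
    have h1 : condKer s P.PX w = (P.PX w)[|s] := if_neg (left_ne_zero_of_mul hw)
    have h2 : condKer t P.PY w = (P.PY w)[|t] := if_neg (right_ne_zero_of_mul hw)
    rw [Kernel.prod_apply, h1, h2, prod_cond]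
  have hint : ∀ f : P.W → ℝ≥0∞, Measurable f →
      ∫⁻ w, f w ∂PW' = p⁻¹ * ∫⁻ w, P.channel w (s ×ˢ t) * f w ∂P.PW := by
    intro f hf
    rw [hPW', lintegral_smul_measure, lintegral_withDensity_eq_lintegral_mul _ hgm hf]
    rfl
  have hlaw : P'.lawXY = P.lawXY[|s ×ˢ t] := by
    ext u hu
    rw [h1, Measure.bind_apply hu (Kernel.aemeasurable _), cond_apply hR,
      P.lawXY_apply (hR.inter hu), ← hp, hint _ (Kernel.measurable_coe _ hu)]
    congr 1
    refine lintegral_congr fun w => ?_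
    by_cases hw : P.channel w (s ×ˢ t) = 0
    · rw [hw, zero_mul, measure_mono_null Set.inter_subset_left hw]
    · rw [hch w hw, cond_apply hR, ← mul_assoc, ENNReal.mul_inv_cancel hw (measure_ne_top _ _),
        one_mul]
  refine ⟨P', hlaw, ?_⟩
  rw [h2, P.info_eq, hint _ (measurable_klDiv_kernel _ _), ← mul_assoc,
    ENNReal.mul_inv_cancel h hpt, one_mul, ← h1, hlaw]
  refine lintegral_mono fun w => ?_
  by_cases hw : P.channel w (s ×ˢ t) = 0
  · rw [hw, zero_mul]; exact zero_le
  · rw [hch w hw]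
    exact measure_mul_klDiv_cond_le _ _ _ hw

/-- The self-information `-log π(z)`. -/
noncomputable def selfInfo {A : Type*} [MeasurableSpace A] (π : Measure A) (z : A) : ℝ≥0∞ :=
  ENNReal.ofReal (Real.log (π.real {z})⁻¹)

/-- The point mass at z is dominated by π/π(z), so `klDiv_le_add_log` applies with κ = μ and
constant 1/π(z). -/
lemma klDiv_dirac_le {A : Type*} [MeasurableSpace A] [DiscreteMeasurableSpace A] [Countable A]
    (π : Measure A) [IsProbabilityMeasure π] {z : A} (h : π {z} ≠ 0) :
    klDiv (Measure.dirac z) π ≤ selfInfo π z := by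
  have hpos : 0 < π.real {z} := ENNReal.toReal_pos h (measure_ne_top _ _)
  have := klDiv_le_add_log (Measure.dirac z) (Measure.dirac z) π (π.real {z})⁻¹
    (one_le_inv_iff₀.2 ⟨hpos, measureReal_le_one⟩) ?_
  · simpa [selfInfo] using this
  · intro a
    by_cases ha : a = z
    · subst ha
      rw [ENNReal.ofReal_inv_of_pos hpos, measureReal_def, ENNReal.ofReal_toReal (measure_ne_top _ _),
        ENNReal.inv_mul_cancel h (measure_ne_top _ _)]
      exact prob_le_one
    · rw [Measure.dirac_apply' _ (measurableSet_singleton a)]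
      simp [Ne.symm ha]

/-- Completing a triple whose law is dominated by `π` to one with law `π`; the rest `r` of `π`
is generated by `W = (X, Y)`. -/
lemma exists_markovTriple_add (P : MarkovTriple 𝒳 𝒴) (π r : Measure (𝒳 × 𝒴))
    [IsProbabilityMeasure π] (c : ℝ) (hc : 0 < c) (hc1 : c ≤ 1)
    (hπ : π = ENNReal.ofReal c • P.lawXY + r) :
    ∃ P' : MarkovTriple 𝒳 𝒴, P'.lawXY = π ∧
      P'.info ≤ P.info + ENNReal.ofReal (Real.log c⁻¹) + ∫⁻ z, selfInfo π z ∂r := by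
  -- The space of W must live in `Type`, so the countable set of pairs is replaced by a small copy.
  let Z := Shrink.{0} (𝒳 × 𝒴)
  let _ : MeasurableSpace Z := ⊤
  let e : 𝒳 × 𝒴 ≃ Z := equivShrink _
  have hle : r ≤ π := by rw [hπ]; exact Measure.le_add_left le_rfl
  have : IsFiniteMeasure r := ⟨(hle _).trans_lt (measure_lt_top _ _)⟩
  -- A mixture: the old W with weight c, and on the other summand W = (X,Y) distributed as r,
  -- followed by Dirac channels.
  set PW' : Measure (P.W ⊕ Z) := ENNReal.ofReal c • (P.PW : Measure P.W).map Sum.inl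
    + (r.map e).map Sum.inr with hPW'
  have hinl : Measurable (Sum.inl : P.W → P.W ⊕ Z) := measurable_inl
  have hinr : Measurable (Sum.inr : Z → P.W ⊕ Z) := measurable_inr
  have he : Measurable e := .of_discrete
  have hint : ∀ f : P.W ⊕ Z → ℝ≥0∞, Measurable f → ∫⁻ w, f w ∂PW' =
      ENNReal.ofReal c * ∫⁻ w, f (Sum.inl w) ∂P.PW + ∫⁻ z, f (Sum.inr (e z)) ∂r := by
    intro f hf
    rw [hPW', lintegral_add_measure, lintegral_smul_measure, lintegral_map hf hinl,
      lintegral_map hf hinr, smul_eq_mul]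
    congr 1
    exact lintegral_map (hf.comp hinr) he
  have hprob : IsProbabilityMeasure PW' := by
    constructor
    have h1 := hint 1 measurable_one
    have h2 : π Set.univ = 1 := measure_univ
    rw [hπ] at h2
    simp only [Pi.one_apply, lintegral_const, measure_univ, one_mul, mul_one] at h1
    rw [h1, ← h2]
    simp
  let KX : Kernel (P.W ⊕ Z) 𝒳 := ⟨Sum.elim P.PX fun z => Measure.dirac (e.symm z).1,
    P.PX.measurable.sumElim .of_discrete⟩
  let KY : Kernel (P.W ⊕ Z) 𝒴 := ⟨Sum.elim P.PY fun z => Measure.dirac (e.symm z).2,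
    P.PY.measurable.sumElim .of_discrete⟩
  have hKX : IsMarkovKernel KX := by
    constructor
    rintro (w | z)
    · exact P.markovX.1 w
    · exact Measure.dirac.isProbabilityMeasure
  have hKY : IsMarkovKernel KY := by
    constructor
    rintro (w | z)
    · exact P.markovY.1 w
    · exact Measure.dirac.isProbabilityMeasure
  obtain ⟨P', h1, h2⟩ := MarkovTriple.exists_of_kernels PW' KX KY
  have hl : ∀ w, (KX ×ₖ KY) (Sum.inl w) = P.channel w := by
    intro w
    rw [Kernel.prod_apply, P.channel_apply]
    rfl
  have hr : ∀ z, (KX ×ₖ KY) (Sum.inr (e z)) = Measure.dirac z := by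
    intro z
    have h1 : KX (Sum.inr (e z)) = Measure.dirac z.1 := by
      change Measure.dirac (e.symm (e z)).1 = _
      rw [e.symm_apply_apply]
    have h2 : KY (Sum.inr (e z)) = Measure.dirac z.2 := by
      change Measure.dirac (e.symm (e z)).2 = _
      rw [e.symm_apply_apply]
    rw [Kernel.prod_apply, h1, h2, Measure.dirac_prod_dirac]
  have hlaw : P'.lawXY = π := by
    ext u hu
    rw [h1, Measure.bind_apply hu (Kernel.aemeasurable _), hint _ (Kernel.measurable_coe _ hu)]
    simp only [hl, hr]
    rw [← P.lawXY_apply hu]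
    conv_rhs => rw [hπ]
    simp only [Measure.dirac_apply' _ hu, Measure.add_apply, Measure.smul_apply, smul_eq_mul]
    rw [lintegral_indicator_one hu]
  refine ⟨P', hlaw, ?_⟩
  rw [h2, ← h1, hlaw, hint _ (measurable_klDiv_kernel _ π)]
  simp only [hl, hr]
  refine add_le_add ?_ ?_
  -- On the old part the reference law changes from `P.lawXY` to π ≥ c `P.lawXY`, which costs at
  -- most log(1/c).
  · have h1 : ∀ z, P.lawXY {z} ≤ ENNReal.ofReal c⁻¹ * π {z} := by
      intro z
      have : ENNReal.ofReal c * P.lawXY {z} ≤ π {z} := by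
        rw [hπ, Measure.add_apply]
        exact le_self_add
      calc P.lawXY {z} = ENNReal.ofReal c⁻¹ * (ENNReal.ofReal c * P.lawXY {z}) := by
            rw [← mul_assoc, ← ENNReal.ofReal_mul (by positivity), inv_mul_cancel₀ hc.ne']
            simp
        _ ≤ _ := by gcongr
    calc ENNReal.ofReal c * ∫⁻ w, klDiv (P.channel w) π ∂P.PW
        ≤ 1 * ∫⁻ w, klDiv (P.channel w) π ∂P.PW := by
          gcongr
          simpa using ENNReal.ofReal_le_ofReal hc1
      _ ≤ ∫⁻ w, (klDiv (P.channel w) P.lawXY + ENNReal.ofReal (Real.log c⁻¹)) ∂P.PW := by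
          rw [one_mul]
          exact lintegral_mono fun w => klDiv_le_add_log _ _ _ _ ((one_le_inv₀ hc).2 hc1) h1
      _ = _ := by
          rw [lintegral_add_right _ measurable_const, ← P.info_eq]
          simp
  · refine lintegral_mono_ae ?_
    have := (Measure.absolutelyContinuous_of_le hle).ae_le (ae_measure_singleton_ne_zero π)
    filter_upwards [this] with z hz
    exact klDiv_dirac_le π hz

end Discrete

/-! ### Continuity of Wyner's common information under truncation -/

section Limits

variable {𝒳 𝒴 : Type*} [MeasurableSpace 𝒳] [DiscreteMeasurableSpace 𝒳] [Countable 𝒳]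
  [MeasurableSpace 𝒴] [DiscreteMeasurableSpace 𝒴] [Countable 𝒴]

/-- Since log(1/p) ≤ p^(-s)/s, a negative moment bounds the Shannon entropy. -/
lemma lintegral_selfInfo_ne_top {A : Type*} [MeasurableSpace A] [DiscreteMeasurableSpace A]
    [Countable A] (π : Measure A) [IsProbabilityMeasure π] {s : ℝ} (hs : 0 < s)
    (h : ∫⁻ z, π {z} ^ (-s) ∂π ≠ ∞) : ∫⁻ z, selfInfo π z ∂π ≠ ∞ := by
  have : ∫⁻ z, selfInfo π z ∂π ≤ ∫⁻ z, ENNReal.ofReal s⁻¹ * π {z} ^ (-s) ∂π := by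
    refine lintegral_mono_ae ?_
    filter_upwards [ae_measure_singleton_ne_zero π] with z hz
    have hpos : 0 < π.real {z} := ENNReal.toReal_pos hz (measure_ne_top _ _)
    rw [selfInfo, ← ENNReal.ofReal_toReal (measure_ne_top π {z}),
      ENNReal.ofReal_rpow_of_pos (by exact hpos), ← ENNReal.ofReal_mul (by positivity)]
    refine ENNReal.ofReal_le_ofReal ?_
    have := Real.log_le_rpow_div (inv_nonneg.2 hpos.le) hs
    rw [Real.inv_rpow hpos.le, ← Real.rpow_neg hpos.le] at this
    rw [mul_comm, ← div_eq_mul_inv]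
    exact this
  refine ne_top_of_le_ne_top ?_ this
  rw [lintegral_const_mul _ .of_discrete]
  exact ENNReal.mul_ne_top ENNReal.ofReal_ne_top h

lemma wynerCI_le_of_add (P : MarkovTriple 𝒳 𝒴) (π r : Measure (𝒳 × 𝒴))
    [IsProbabilityMeasure π] (c : ℝ) (hc : 0 < c) (hc1 : c ≤ 1)
    (hπ : π = ENNReal.ofReal c • P.lawXY + r) :
    wynerCI π ≤ P.info + ENNReal.ofReal (Real.log c⁻¹) + ∫⁻ z, selfInfo π z ∂r := by
  obtain ⟨P', h1, h2⟩ := exists_markovTriple_add P π r c hc hc1 hπ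
  exact (iInf₂_le P' h1).trans h2

/-- The loss in passing from `π` to `π` conditioned on `R`. -/
noncomputable def condLoss {A : Type*} [MeasurableSpace A] (π : Measure A) (R : Set A) : ℝ≥0∞ :=
  ENNReal.ofReal (Real.log (π.real R)⁻¹) + ∫⁻ z in Rᶜ, selfInfo π z ∂π

/-- The completion is applied with c = π(R) and r the restriction of π to the complement; here R
need not be a rectangle. -/
lemma wynerCI_le_cond (π : Measure (𝒳 × 𝒴)) [IsProbabilityMeasure π] (R : Set (𝒳 × 𝒴))
    (hR : π R ≠ 0) : wynerCI π ≤ wynerCI π[|R] + condLoss π R := by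
  have hRm : MeasurableSet R := .of_discrete
  have : wynerCI π - condLoss π R ≤ wynerCI π[|R] := by
    refine le_iInf₂ fun P hP => ?_
    rw [tsub_le_iff_right, condLoss, ← add_assoc]
    refine wynerCI_le_of_add P π _ _ (ENNReal.toReal_pos hR (measure_ne_top _ _)) measureReal_le_one ?_
    rw [hP, measureReal_def, ENNReal.ofReal_toReal (measure_ne_top _ _), ProbabilityTheory.cond, smul_smul,
      ENNReal.mul_inv_cancel hR (measure_ne_top _ _), one_smul, Measure.restrict_add_restrict_compl hRm]
  rwa [tsub_le_iff_right] at this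

lemma measure_mul_wynerCI_cond_le (π : Measure (𝒳 × 𝒴)) [IsProbabilityMeasure π] (s : Set 𝒳)
    (t : Set 𝒴) : π (s ×ˢ t) * wynerCI π[|s ×ˢ t] ≤ wynerCI π := by
  by_cases h : π (s ×ˢ t) = 0
  · simp [h]
  refine le_iInf₂ fun P hP => ?_
  obtain ⟨P', h1, h2⟩ := exists_markovTriple_cond P s t (by rwa [hP])
  rw [hP] at h1 h2
  exact le_trans (mul_le_mul_right (iInf₂_le P' h1) _) h2

lemma wynerCI_map_le {𝒳' 𝒴' : Type*} [MeasurableSpace 𝒳'] [DiscreteMeasurableSpace 𝒳']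
    [Countable 𝒳'] [MeasurableSpace 𝒴'] [DiscreteMeasurableSpace 𝒴'] [Countable 𝒴']
    (π : Measure (𝒳 × 𝒴)) (g : 𝒳 → 𝒳') (h : 𝒴 → 𝒴') :
    wynerCI (π.map (Prod.map g h)) ≤ wynerCI π := by
  refine le_iInf₂ fun P hP => ?_
  obtain ⟨P', h1, h2⟩ := P.exists_map g h
  rw [hP] at h1
  exact (iInf₂_le P' h1).trans h2

section Exhaustion

variable {A : Type*} [MeasurableSpace A] [DiscreteMeasurableSpace A] [Countable A]
  (π : Measure A) [IsProbabilityMeasure π] (R : ℕ → Set A)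

lemma tendsto_measure_exhaustion (hmono : Monotone R) (hU : ⋃ k, R k = Set.univ) :
    Tendsto (fun k => π (R k)) atTop (𝓝 1) := by
  have := tendsto_measure_iUnion_atTop (μ := π) hmono
  rwa [hU, measure_univ] at this

/-- Finite entropy makes the integral of the self-information absolutely continuous, so it vanishes
along sets of vanishing mass. -/
lemma tendsto_condLoss (h : ∫⁻ z, selfInfo π z ∂π ≠ ∞) (hR : Tendsto (fun k => π (R k)) atTop (𝓝 1)) :
    Tendsto (fun k => condLoss π (R k)) atTop (𝓝 0) := by
  have h1 : Tendsto (fun k => π.real (R k)) atTop (𝓝 1) := by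
    exact (ENNReal.tendsto_toReal ENNReal.one_ne_top).comp hR
  have h2 : Tendsto (fun k => ENNReal.ofReal (Real.log (π.real (R k))⁻¹)) atTop (𝓝 0) := by
    have : Tendsto (fun k => Real.log (π.real (R k))⁻¹) atTop (𝓝 (Real.log 1⁻¹)) :=
      (h1.inv₀ one_ne_zero).log (by norm_num)
    simpa using ENNReal.tendsto_ofReal this
  have h3 : Tendsto (fun k => π (R k)ᶜ) atTop (𝓝 0) := by
    have : ∀ k, π (R k)ᶜ = 1 - π (R k) := fun k => prob_compl_eq_one_sub .of_discrete
    simp_rw [this]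
    simpa using ENNReal.Tendsto.sub tendsto_const_nhds hR (Or.inl ENNReal.one_ne_top)
  simpa [condLoss] using h2.add (tendsto_setLIntegral_zero h h3)

end Exhaustion

/-- The square `[-k, k]²` in the labels `e`, `f`. -/
def box (e : 𝒳 ≃ ℤ) (f : 𝒴 ≃ ℤ) (k : ℕ) : Set (𝒳 × 𝒴) :=
  {x | |e x| ≤ (k : ℤ)} ×ˢ {y | |f y| ≤ (k : ℤ)}

lemma condTrunc_eq (e : 𝒳 ≃ ℤ) (f : 𝒴 ≃ ℤ) (π : Measure (𝒳 × 𝒴)) (k : ℕ) :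
    condTrunc e f π k = π[|box e f k] := rfl

lemma tendsto_measure_box (e : 𝒳 ≃ ℤ) (f : 𝒴 ≃ ℤ) (π : Measure (𝒳 × 𝒴)) [IsProbabilityMeasure π] :
    Tendsto (fun k => π (box e f k)) atTop (𝓝 1) := by
  refine tendsto_measure_exhaustion π _ ?_ ?_
  · intro k l hkl p hp
    have : (k : ℤ) ≤ l := by exact_mod_cast hkl
    exact ⟨le_trans hp.1 this, le_trans hp.2 this⟩
  · refine Set.eq_univ_of_forall fun p => Set.mem_iUnion.2 ⟨(|e p.1| + |f p.2|).toNat, ?_, ?_⟩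
    · have := abs_nonneg (e p.1)
      have := abs_nonneg (f p.2)
      change |e p.1| ≤ _
      omega
    · have := abs_nonneg (e p.1)
      have := abs_nonneg (f p.2)
      change |f p.2| ≤ _
      omega

lemma finite_box (e : 𝒳 ≃ ℤ) (f : 𝒴 ≃ ℤ) (k : ℕ) : (box e f k).Finite := by
  refine Set.Finite.prod ?_ ?_
  · refine ((Set.finite_Icc (-(k : ℤ)) k).preimage e.injective.injOn).subset fun x hx => ?_
    exact abs_le.1 hx
  · refine ((Set.finite_Icc (-(k : ℤ)) k).preimage f.injective.injOn).subset fun x hx => ?_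
    exact abs_le.1 hx

/-- A squeeze: completion gives the lower bound `wynerCI π - condLoss`, and conditioning on the box
gives the upper bound `wynerCI π` divided by the mass of the box. -/
lemma tendsto_wynerCI_condTrunc (e : 𝒳 ≃ ℤ) (f : 𝒴 ≃ ℤ) (π : Measure (𝒳 × 𝒴))
    [IsProbabilityMeasure π] (h : ∫⁻ z, selfInfo π z ∂π ≠ ∞) :
    Tendsto (fun k : ℕ => wynerCI (condTrunc e f π k)) atTop (𝓝 (wynerCI π)) := by
  have hR := tendsto_measure_box e f π
  have hloss := tendsto_condLoss π _ h hR
  have hpos : ∀ᶠ k in atTop, π (box e f k) ≠ 0 := hR.eventually_ne one_ne_zero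
  have hlow : Tendsto (fun k => wynerCI π - condLoss π (box e f k)) atTop (𝓝 (wynerCI π)) := by
    simpa using ENNReal.Tendsto.sub (tendsto_const_nhds (x := wynerCI π)) hloss
      (Or.inr ENNReal.zero_ne_top)
  have hup : Tendsto (fun k => (π (box e f k))⁻¹ * wynerCI π) atTop (𝓝 (wynerCI π)) := by
    have := ENNReal.Tendsto.mul_const (b := wynerCI π) (tendsto_inv_iff.2 hR)
      (Or.inl (by simp))
    simpa using this
  refine tendsto_of_tendsto_of_tendsto_of_le_of_le' hlow hup ?_ ?_
  · filter_upwards [hpos] with k hk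
    rw [tsub_le_iff_right, condTrunc_eq]
    exact wynerCI_le_cond π _ hk
  · filter_upwards [hpos] with k hk
    have := measure_mul_wynerCI_cond_le π {x | |e x| ≤ (k : ℤ)} {y | |f y| ≤ (k : ℤ)}
    calc wynerCI (condTrunc e f π k) =
        (π (box e f k))⁻¹ * (π (box e f k) * wynerCI (condTrunc e f π k)) := by
          rw [← mul_assoc, ENNReal.inv_mul_cancel hk (measure_ne_top _ _), one_mul]
      _ ≤ _ := by gcongr; exact this

lemma mapTrunc_eq (e : 𝒳 ≃ ℤ) (f : 𝒴 ≃ ℤ) (π : Measure (𝒳 × 𝒴)) (k : ℕ) :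
    mapTrunc e f π k = π.map (Prod.map (fun x => trunc k (e x)) fun y => trunc k (f y)) := rfl

lemma abs_trunc_le_iff (k : ℕ) (z : ℤ) : |trunc k z| ≤ (k : ℤ) ↔ |z| ≤ (k : ℤ) := by
  unfold trunc
  split_ifs with h
  · rfl
  · refine iff_of_false ?_ h
    rw [abs_of_nonneg (by positivity)]
    omega

/-- The overflow symbol k + 1 lies outside [-k, k], so conditioning on the square discards exactly
the pairs with a truncated coordinate. -/
lemma cond_mapTrunc_map (e : 𝒳 ≃ ℤ) (f : 𝒴 ≃ ℤ) (π : Measure (𝒳 × 𝒴)) (k : ℕ) :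
    (mapTrunc e f π k)[|{x : ℤ | |x| ≤ (k : ℤ)} ×ˢ {y : ℤ | |y| ≤ (k : ℤ)}].map
      (Prod.map e.symm f.symm) = condTrunc e f π k ∧
    mapTrunc e f π k ({x : ℤ | |x| ≤ (k : ℤ)} ×ˢ {y : ℤ | |y| ≤ (k : ℤ)}) = π (box e f k) := by
  have h0 : mapTrunc e f π k ({x : ℤ | |x| ≤ (k : ℤ)} ×ˢ {y : ℤ | |y| ≤ (k : ℤ)}) =
      π (box e f k) := by
    rw [mapTrunc_eq, Measure.map_apply .of_discrete .of_discrete]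
    congr 1
    ext p
    exact and_congr (abs_trunc_le_iff k _) (abs_trunc_le_iff k _)
  refine ⟨?_, h0⟩
  ext s hs
  rw [Measure.map_apply .of_discrete hs, cond_apply .of_discrete, h0, condTrunc_eq,
    cond_apply .of_discrete, mapTrunc_eq, Measure.map_apply .of_discrete .of_discrete]
  congr 2
  ext p
  change (|trunc k (e p.1)| ≤ (k : ℤ) ∧ |trunc k (f p.2)| ≤ (k : ℤ)) ∧
    (e.symm (trunc k (e p.1)), f.symm (trunc k (f p.2))) ∈ s ↔
    (|e p.1| ≤ (k : ℤ) ∧ |f p.2| ≤ (k : ℤ)) ∧ p ∈ s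
  rw [abs_trunc_le_iff, abs_trunc_le_iff]
  refine and_congr_right fun hp => ?_
  rw [trunc, trunc, if_pos hp.1, if_pos hp.2, e.symm_apply_apply, f.symm_apply_apply]

/-- The truncated law is a coordinatewise image of π, whence the upper bound. Conditioning it on the
square returns `condTrunc` up to relabelling, whose limit is known, whence the lower bound. -/
lemma tendsto_wynerCI_mapTrunc (e : 𝒳 ≃ ℤ) (f : 𝒴 ≃ ℤ) (π : Measure (𝒳 × 𝒴))
    [IsProbabilityMeasure π] (h : ∫⁻ z, selfInfo π z ∂π ≠ ∞) :
    Tendsto (fun k : ℕ => wynerCI (mapTrunc e f π k)) atTop (𝓝 (wynerCI π)) := by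
  have hR := tendsto_measure_box e f π
  have hlow : Tendsto (fun k => π (box e f k) * wynerCI (condTrunc e f π k)) atTop
      (𝓝 (wynerCI π)) := by
    simpa using ENNReal.Tendsto.mul hR (Or.inl one_ne_zero) (tendsto_wynerCI_condTrunc e f π h)
      (Or.inr ENNReal.one_ne_top)
  refine tendsto_of_tendsto_of_tendsto_of_le_of_le hlow tendsto_const_nhds (fun k => ?_)
    fun k => wynerCI_map_le π (fun x => trunc k (e x)) fun y => trunc k (f y)
  obtain ⟨h1, h2⟩ := cond_mapTrunc_map e f π k
  have : IsProbabilityMeasure (mapTrunc e f π k) := by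
    rw [mapTrunc_eq]; exact Measure.isProbabilityMeasure_map .of_discrete
  simp only
  rw [← h1, ← h2]
  exact (mul_le_mul_right (wynerCI_map_le _ _ _) _).trans (measure_mul_wynerCI_cond_le _ _ _)

end Limits

/-! ### The relaxed common information as ε ↓ 0 -/

section Relaxed

/-- The pointwise Hellinger bound, from log √t ≥ 1 - 1/√t. It forces a density with small `klFun` to
be close to 1. -/
lemma sq_sqrt_sub_one_le_klFun {t : ℝ} (ht : 0 ≤ t) : (√t - 1) ^ 2 ≤ klFun t := by
  rcases ht.eq_or_lt with rfl | ht
  · simp [klFun_zero]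
  have h1 : 0 < √t := Real.sqrt_pos.2 ht
  have h2 := Real.one_sub_inv_le_log_of_pos h1
  have h3 : Real.log t = 2 * Real.log √t := by
    conv_lhs => rw [← Real.sq_sqrt ht.le]
    rw [Real.log_pow]
    norm_num
  have h4 : t = √t ^ 2 := (Real.sq_sqrt ht.le).symm
  rw [klFun_apply, h3]
  have h5 : t * (1 - (√t)⁻¹) ≤ t * Real.log √t := mul_le_mul_of_nonneg_left h2 ht.le
  have h6 : t * (√t)⁻¹ = √t := by
    rw [← div_eq_mul_inv]
    exact Real.div_sqrt
  nlinarith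

variable {A : Type*} [MeasurableSpace A] [DiscreteMeasurableSpace A] [Countable A]

/-- A small relative entropy forces the point masses to be close. -/
lemma eventually_singleton_le (π : Measure A) [IsProbabilityMeasure π] {b : ℝ} (hb : 1 < b) (z : A) :
    ∀ᶠ ε : ℝ≥0∞ in 𝓝[>] 0, ∀ μ : Measure A, IsProbabilityMeasure μ → klDiv μ π ≤ ε →
      μ.real {z} ≤ b * π.real {z} ∧ π.real {z} ≤ b * μ.real {z} := by
  have hsb : 1 < √b := Real.lt_sqrt_of_sq_lt (by simpa using hb)
  have hsb' : √b⁻¹ < 1 := by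
    rw [Real.sqrt_lt' one_pos]; simpa using inv_lt_one_of_one_lt₀ hb
  -- If `klFun t` < η, the Hellinger bound excludes both t > b and t < 1/b.
  set η : ℝ := min ((√b - 1) ^ 2) ((√b⁻¹ - 1) ^ 2) with hη
  have hηpos : 0 < η := lt_min (pow_pos (by linarith) 2) (by
    have : √b⁻¹ - 1 ≠ 0 := by linarith
    positivity)
  by_cases hz : π {z} = 0
  · have : ∀ᶠ ε : ℝ≥0∞ in 𝓝[>] 0, ε < ∞ :=
      eventually_nhdsWithin_of_eventually_nhds (eventually_lt_nhds ENNReal.zero_lt_top)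
    filter_upwards [this] with ε hε μ _ hμ
    have hac := (klDiv_ne_top_iff.1 (hμ.trans_lt hε).ne).1
    simp [measureReal_def, hz, hac hz]
  have hp : 0 < π.real {z} := ENNReal.toReal_pos hz (measure_ne_top _ _)
  have : ∀ᶠ ε : ℝ≥0∞ in 𝓝[>] 0, ε < ENNReal.ofReal (η * π.real {z}) :=
    eventually_nhdsWithin_of_eventually_nhds
      (eventually_lt_nhds (ENNReal.ofReal_pos.2 (mul_pos hηpos hp)))
  filter_upwards [this] with ε hε μ _ hμ
  have hlt := hμ.trans_lt hε
  have hac := (klDiv_ne_top_iff.1 (hlt.trans ENNReal.ofReal_lt_top).ne).1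
  set t := (ratio μ π z).toReal with ht
  have ht0 : 0 ≤ t := ENNReal.toReal_nonneg
  have htm : μ.real {z} = t * π.real {z} := by
    rw [measureReal_def, ← ratio_mul μ π hac z, ENNReal.toReal_mul, ht, measureReal_def]
  have hk : klFun t < η := by
    -- The integrand of the divergence is nonnegative, so the single atom z gives a lower bound.
    have h1 : ENNReal.ofReal (klFun t * π.real {z}) ≤ klDiv μ π := by
      rw [klDiv_eq_lintegral_ratio μ π hac, ENNReal.ofReal_mul (klFun_nonneg ht0), measureReal_def,
        ENNReal.ofReal_toReal (measure_ne_top _ _), ht,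
        ← lintegral_singleton (fun a => ENNReal.ofReal (klFun (ratio μ π a).toReal))]
      exact setLIntegral_le_lintegral _ _
    have h2 := (ENNReal.ofReal_lt_ofReal_iff (mul_pos hηpos hp)).1 (h1.trans_lt hlt)
    exact lt_of_mul_lt_mul_right h2 hp.le
  have hkt := (sq_sqrt_sub_one_le_klFun ht0).trans_lt hk
  have hb0 : 0 < b := by linarith
  rw [htm]
  constructor
  · refine mul_le_mul_of_nonneg_right ?_ hp.le
    by_contra! h
    have h1 : √b ≤ √t := Real.sqrt_le_sqrt h.le
    have h2 := hkt.trans_le (min_le_left _ _)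
    nlinarith
  · have : b⁻¹ ≤ t := by
      by_contra! h
      have h1 : √t ≤ √b⁻¹ := Real.sqrt_le_sqrt h.le
      have h2 := hkt.trans_le (min_le_right _ _)
      nlinarith
    have h3 : 1 ≤ b * t := by
      rwa [inv_le_iff_one_le_mul₀' hb0] at this
    nlinarith

lemma measureReal_le_mul_of_singleton {μ ν : Measure A} [IsFiniteMeasure μ] [IsFiniteMeasure ν]
    {C : ℝ} (hC : 0 ≤ C) {R : Set A} (h : ∀ z ∈ R, μ.real {z} ≤ C * ν.real {z}) :
    μ.real R ≤ C * ν.real R := by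
  have h1 : μ R ≤ ENNReal.ofReal C * ν R := by
    rw [← Set.biUnion_of_singleton R,
      measure_biUnion R.to_countable (fun a _ b _ hab => by simpa using hab)
        (fun a _ => measurableSet_singleton a),
      measure_biUnion R.to_countable (fun a _ b _ hab => by simpa using hab)
        (fun a _ => measurableSet_singleton a), ← ENNReal.tsum_mul_left]
    refine ENNReal.tsum_le_tsum fun z => ?_
    have := ENNReal.ofReal_le_ofReal (h z.1 z.2)
    rwa [ENNReal.ofReal_mul hC, ofReal_measureReal, ofReal_measureReal] at this
  have := ENNReal.toReal_mono (ENNReal.mul_ne_top ENNReal.ofReal_ne_top (measure_ne_top _ _)) h1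
  rwa [ENNReal.toReal_mul, ENNReal.toReal_ofReal hC] at this

lemma le_of_singleton_le {μ ν : Measure A} (h : ∀ z, μ {z} ≤ ν {z}) : μ ≤ ν := by
  refine Measure.le_iff.2 fun R _ => ?_
  rw [← Set.biUnion_of_singleton R,
    measure_biUnion R.to_countable (fun a _ b _ hab => by simpa using hab)
      (fun a _ => measurableSet_singleton a),
    measure_biUnion R.to_countable (fun a _ b _ hab => by simpa using hab)
      (fun a _ => measurableSet_singleton a)]
  exact ENNReal.tsum_le_tsum fun z => h z

/-- The loss in passing from a law close to `π` on `R` to `π`. -/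
noncomputable def approxLoss (π : Measure A) (b : ℝ) (R : Set A) : ℝ≥0∞ :=
  ENNReal.ofReal (Real.log (b ^ 2 / π.real R)) +
    (ENNReal.ofReal (1 - (b ^ 4)⁻¹) * ∫⁻ z, selfInfo π z ∂π + ∫⁻ z in Rᶜ, selfInfo π z ∂π)

variable {𝒳 𝒴 : Type*} [MeasurableSpace 𝒳] [DiscreteMeasurableSpace 𝒳] [Countable 𝒳]
  [MeasurableSpace 𝒴] [DiscreteMeasurableSpace 𝒴] [Countable 𝒴]

/-- The triple is first conditioned on the rectangle, so that its law is dominated by a multiple of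
π, and then completed to law π. -/
lemma wynerCI_le_of_close (π : Measure (𝒳 × 𝒴)) [IsProbabilityMeasure π] {b : ℝ} (hb : 1 < b)
    (s : Set 𝒳) (t : Set 𝒴) (hR : π (s ×ˢ t) ≠ 0) (P : MarkovTriple 𝒳 𝒴)
    (h : ∀ z ∈ s ×ˢ t, P.lawXY.real {z} ≤ b * π.real {z} ∧ π.real {z} ≤ b * P.lawXY.real {z}) :
    wynerCI π ≤ ENNReal.ofReal (b / π.real (s ×ˢ t)) * P.info + approxLoss π b (s ×ˢ t) := by
  set R := s ×ˢ t with hRdef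
  have hRm : MeasurableSet R := .of_discrete
  have hb0 : 0 < b := by linarith
  set μ := P.lawXY with hμ
  have hp : 0 < π.real R := ENNReal.toReal_pos hR (measure_ne_top _ _)
  have hp1 : π.real R ≤ 1 := measureReal_le_one
  have hq1 := measureReal_le_mul_of_singleton hb0.le fun z hz => (h z hz).1
  have hq2 := measureReal_le_mul_of_singleton hb0.le fun z hz => (h z hz).2
  have hq : 0 < μ.real R := by nlinarith
  have hq0 : μ R ≠ 0 := by
    intro h0
    rw [measureReal_def, h0] at hq
    simp at hq
  obtain ⟨P', h1, h2⟩ := exists_markovTriple_cond P s t hq0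
  rw [← hRdef, ← hμ] at h1 h2
  -- On R the conditioned mass μ(z)/μ(R) is at most b² π(z)/π(R), so this is a weight for which c
  -- times the conditioned law stays below π.
  set c : ℝ := π.real R / b ^ 2 with hc
  have hc0 : 0 < c := by positivity
  have hc1 : c ≤ 1 := (div_le_one (by positivity)).2 (by nlinarith)
  have hcond : ∀ z ∈ R, (P'.lawXY).real {z} = μ.real {z} / μ.real R := by
    intro z hz
    rw [h1, measureReal_def, cond_apply hRm, Set.inter_eq_right.2 (Set.singleton_subset_iff.2 hz),
      ENNReal.toReal_mul, ENNReal.toReal_inv, div_eq_inv_mul]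
    rfl
  have hcond' : ∀ z ∉ R, P'.lawXY {z} = 0 := by
    intro z hz
    rw [h1, cond_apply hRm, Set.inter_singleton_eq_empty.2 hz, measure_empty, mul_zero]
  have hle : ENNReal.ofReal c • P'.lawXY ≤ π := by
    refine le_of_singleton_le fun z => ?_
    rw [Measure.smul_apply, smul_eq_mul]
    by_cases hz : z ∈ R
    · rw [← ofReal_measureReal (μ := P'.lawXY), ← ENNReal.ofReal_mul hc0.le,
        ← ofReal_measureReal (μ := π), hcond z hz]
      refine ENNReal.ofReal_le_ofReal ?_
      rw [hc, div_mul_div_comm, div_le_iff₀ (by positivity)]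
      calc π.real R * μ.real {z} ≤ (b * μ.real R) * (b * π.real {z}) :=
            mul_le_mul hq2 (h z hz).1 measureReal_nonneg (by positivity)
        _ = _ := by ring
    · rw [hcond' z hz, mul_zero]; exact zero_le
  set r := π - ENNReal.ofReal c • P'.lawXY with hr
  have : IsFiniteMeasure (ENNReal.ofReal c • P'.lawXY) :=
    ⟨(hle _).trans_lt (measure_lt_top _ _)⟩
  have hπ : π = ENNReal.ofReal c • P'.lawXY + r := by
    rw [add_comm, hr, Measure.sub_add_cancel_of_le hle]
  have hrπ : r ≤ π := Measure.sub_le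
  have : IsFiniteMeasure r := ⟨(hrπ _).trans_lt (measure_lt_top _ _)⟩
  -- The completed part covers at least π(z)/b⁴ of each point of R: one factor b for μ(z), one for
  -- μ(R), and b² from c.
  have hrR : r.restrict R ≤ ENNReal.ofReal (1 - (b ^ 4)⁻¹) • π := by
    have hb4 : (b ^ 4)⁻¹ ≤ 1 := inv_le_one_of_one_le₀ (one_le_pow₀ hb.le)
    refine le_of_singleton_le fun z => ?_
    rw [Measure.restrict_apply (measurableSet_singleton z), Measure.smul_apply, smul_eq_mul]
    by_cases hz : z ∈ R
    swap
    · rw [Set.inter_comm, Set.inter_singleton_eq_empty.2 hz, measure_empty]; exact zero_le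
    rw [Set.inter_comm, Set.inter_eq_right.2 (Set.singleton_subset_iff.2 hz)]
    have e1 : π.real {z} = c * (μ.real {z} / μ.real R) + r.real {z} := by
      rw [← hcond z hz]
      conv_lhs => rw [hπ]
      rw [measureReal_add_apply, measureReal_ennreal_smul_apply, ENNReal.toReal_ofReal hc0.le]
    rw [← ofReal_measureReal (μ := r), ← ofReal_measureReal (μ := π),
      ← ENNReal.ofReal_mul (by linarith)]
    refine ENNReal.ofReal_le_ofReal ?_
    have e2 : (b ^ 4)⁻¹ * π.real {z} ≤ c * (μ.real {z} / μ.real R) := by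
      rw [hc, div_mul_div_comm, le_div_iff₀ (by positivity), inv_mul_eq_div, div_mul_eq_mul_div,
        div_le_iff₀ (by positivity)]
      calc π.real {z} * (b ^ 2 * μ.real R) ≤ (b * μ.real {z}) * (b ^ 2 * (b * π.real R)) := by
            gcongr
            exact (h z hz).2
        _ = _ := by ring
    linarith
  have hint : ∫⁻ z, selfInfo π z ∂r ≤ ENNReal.ofReal (1 - (b ^ 4)⁻¹) * ∫⁻ z, selfInfo π z ∂π +
      ∫⁻ z in Rᶜ, selfInfo π z ∂π := by
    rw [← lintegral_add_compl _ hRm]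
    refine add_le_add ?_ ?_
    · refine (lintegral_mono' hrR le_rfl).trans_eq ?_
      rw [lintegral_smul_measure, smul_eq_mul]
    · exact lintegral_mono' (Measure.restrict_mono le_rfl hrπ) le_rfl
  have hinfo : P'.info ≤ ENNReal.ofReal (b / π.real R) * P.info := by
    have : 1 ≤ ENNReal.ofReal (b / π.real R) * μ R := by
      rw [← ofReal_measureReal (μ := μ), ← ENNReal.ofReal_mul (by positivity), ENNReal.one_le_ofReal,
        div_mul_eq_mul_div, le_div_iff₀ hp, one_mul]
      exact hq2
    calc P'.info = 1 * P'.info := (one_mul _).symm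
      _ ≤ ENNReal.ofReal (b / π.real R) * μ R * P'.info := by gcongr
      _ ≤ _ := by rw [mul_assoc]; gcongr
  refine (wynerCI_le_of_add P' π r c hc0 hc1 hπ).trans ?_
  rw [approxLoss, ← add_assoc]
  have hcinv : c⁻¹ = b ^ 2 / π.real R := by rw [hc, inv_div]
  rw [hcinv]
  calc _ ≤ ENNReal.ofReal (b / π.real R) * P.info + ENNReal.ofReal (Real.log (b ^ 2 / π.real R)) +
      (ENNReal.ofReal (1 - (b ^ 4)⁻¹) * ∫⁻ z, selfInfo π z ∂π + ∫⁻ z in Rᶜ, selfInfo π z ∂π) := by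
        gcongr
    _ = _ := by ring

/-- Finiteness of the rectangle gives one threshold for ε that works at all its points. -/
lemma eventually_le_relaxedWynerCI (π : Measure (𝒳 × 𝒴)) [IsProbabilityMeasure π] {b : ℝ}
    (hb : 1 < b) (s : Set 𝒳) (t : Set 𝒴) (hfin : (s ×ˢ t).Finite) (hR : π (s ×ˢ t) ≠ 0) :
    ∀ᶠ ε in 𝓝[>] 0, ENNReal.ofReal (π.real (s ×ˢ t) / b) * (wynerCI π - approxLoss π b (s ×ˢ t)) ≤
      relaxedWynerCI π ε := by
  have hp : 0 < π.real (s ×ˢ t) := ENNReal.toReal_pos hR (measure_ne_top _ _)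
  have := (eventually_all_finite hfin).2 fun z _ => eventually_singleton_le π hb z
  filter_upwards [this] with ε hε
  refine le_iInf₂ fun P hP => ?_
  have h1 := wynerCI_le_of_close π hb s t hR P fun z hz => hε z hz _ inferInstance hP
  rw [← tsub_le_iff_right] at h1
  calc _ ≤ ENNReal.ofReal (π.real (s ×ˢ t) / b) *
        (ENNReal.ofReal (b / π.real (s ×ˢ t)) * P.info) := by gcongr
    _ = P.info := by
      have hb0 : 0 < b := by linarith
      rw [← mul_assoc, ← ENNReal.ofReal_mul (by positivity), div_mul_div_comm, mul_comm b,
        div_self (by positivity), ENNReal.ofReal_one, one_mul]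

lemma relaxedWynerCI_le (π : Measure (𝒳 × 𝒴)) [IsProbabilityMeasure π] (ε : ℝ≥0∞) :
    relaxedWynerCI π ε ≤ wynerCI π := by
  refine le_iInf₂ fun P hP => iInf₂_le P ?_
  rw [hP, klDiv_self]
  exact zero_le

lemma tendsto_relaxedWynerCI (e : 𝒳 ≃ ℤ) (f : 𝒴 ≃ ℤ) (π : Measure (𝒳 × 𝒴)) [IsProbabilityMeasure π]
    (h : ∫⁻ z, selfInfo π z ∂π ≠ ∞) :
    Tendsto (relaxedWynerCI π) (𝓝[>] 0) (𝓝 (wynerCI π)) := by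
  have hR := tendsto_measure_box e f π
  have hRr : Tendsto (fun k => π.real (box e f k)) atTop (𝓝 1) :=
    (ENNReal.tendsto_toReal ENNReal.one_ne_top).comp hR
  have hb : Tendsto (fun k : ℕ => 1 + 1 / ((k : ℝ) + 1)) atTop (𝓝 1) := by
    simpa using tendsto_one_div_add_atTop_nhds_zero_nat.const_add (1 : ℝ)
  -- The closeness factor shrinks to 1 as the box grows, so a single index k controls both losses.
  set b : ℕ → ℝ := fun k => 1 + 1 / ((k : ℝ) + 1) with hbdef
  have hb1 : ∀ k, 1 < b k := fun k => by
    have : 0 < 1 / ((k : ℝ) + 1) := by positivity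
    simp only [hbdef]; linarith
  have hloss : Tendsto (fun k => approxLoss π (b k) (box e f k)) atTop (𝓝 0) := by
    have h1 : Tendsto (fun k => ENNReal.ofReal (Real.log (b k ^ 2 / π.real (box e f k)))) atTop
        (𝓝 0) := by
      have : Tendsto (fun k => Real.log (b k ^ 2 / π.real (box e f k))) atTop
          (𝓝 (Real.log (1 ^ 2 / 1))) := ((hb.pow 2).div hRr one_ne_zero).log (by norm_num)
      simpa using ENNReal.tendsto_ofReal this
    have h2 : Tendsto (fun k => ENNReal.ofReal (1 - (b k ^ 4)⁻¹) * ∫⁻ z, selfInfo π z ∂π) atTop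
        (𝓝 0) := by
      have h3 : Tendsto (fun k => 1 - (b k ^ 4)⁻¹) atTop (𝓝 (1 - (1 ^ 4)⁻¹)) :=
        ((hb.pow 4).inv₀ (by norm_num)).const_sub 1
      have := ENNReal.Tendsto.mul_const (b := ∫⁻ z, selfInfo π z ∂π) (ENNReal.tendsto_ofReal h3)
        (Or.inr h)
      simpa using this
    have h3 : Tendsto (fun k => ∫⁻ z in (box e f k)ᶜ, selfInfo π z ∂π) atTop (𝓝 0) :=
      tendsto_of_tendsto_of_tendsto_of_le_of_le tendsto_const_nhds (tendsto_condLoss π _ h hR)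
        (fun _ => zero_le) fun _ => le_add_self
    simpa [approxLoss] using h1.add (h2.add h3)
  have hlim : Tendsto (fun k => ENNReal.ofReal (π.real (box e f k) / b k) *
      (wynerCI π - approxLoss π (b k) (box e f k))) atTop (𝓝 (wynerCI π)) := by
    have h1 : Tendsto (fun k => ENNReal.ofReal (π.real (box e f k) / b k)) atTop (𝓝 1) := by
      have := ENNReal.tendsto_ofReal (hRr.div hb one_ne_zero)
      simpa using this
    have h2 : Tendsto (fun k => wynerCI π - approxLoss π (b k) (box e f k)) atTop
        (𝓝 (wynerCI π)) := by
      simpa using ENNReal.Tendsto.sub (tendsto_const_nhds (x := wynerCI π)) hloss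
        (Or.inr ENNReal.zero_ne_top)
    simpa using ENNReal.Tendsto.mul h1 (Or.inl one_ne_zero) h2 (Or.inr ENNReal.one_ne_top)
  refine tendsto_order.2 ⟨fun a ha => ?_, fun a ha => ?_⟩
  -- The index k is fixed first; only then is ε taken small, depending on the k-th box.
  · obtain ⟨k, hk, hk0⟩ := ((hlim.eventually (lt_mem_nhds ha)).and
      (hR.eventually_ne one_ne_zero)).exists
    filter_upwards [eventually_le_relaxedWynerCI π (hb1 k) _ _ (finite_box e f k) hk0] with ε hε
    exact hk.trans_le hε
  · exact Eventually.of_forall fun ε => (relaxedWynerCI_le π ε).trans_lt ha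

end Relaxed

/-! ### Splitting off one letter: chain rules and single-letterization -/

section Discrete

variable {A B : Type*} [MeasurableSpace A] [DiscreteMeasurableSpace A] [Countable A]
  [MeasurableSpace B] [DiscreteMeasurableSpace B] [Countable B]

lemma compProd_singleton (μ : Measure A) [SFinite μ] (κ : Kernel A B) [IsSFiniteKernel κ] (a : A)
    (b : B) : (μ ⊗ₘ κ) {(a, b)} = μ {a} * κ a {b} := by
  rw [← Set.singleton_prod_singleton, Measure.compProd_apply_prod .of_discrete .of_discrete,
    lintegral_singleton, mul_comm]

/-- The chain rule splits off the first marginal, and data processing under the second projection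
bounds the remaining term from below. -/
lemma klDiv_prod_ge (L : Measure (A × B)) [IsProbabilityMeasure L] (π : Measure A)
    [IsProbabilityMeasure π] (ρ : Measure B) [IsProbabilityMeasure ρ] :
    klDiv L.fst π + klDiv L.snd ρ ≤ klDiv L (π.prod ρ) := by
  have : Nonempty B := ρ.nonempty_of_neZero
  have hd := L.disintegrate L.condKernel
  have h1 : klDiv L (π.prod ρ) = klDiv L.fst π + klDiv L (L.fst.prod ρ) := by
    conv_lhs => rw [← hd]
    conv_rhs => rw [← hd]
    rw [← Measure.compProd_const, ← Measure.compProd_const, klDiv_compProd_eq_add, hd]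
  rw [h1]
  gcongr
  have h2 := klDiv_map_le L (L.fst.prod ρ) measurable_snd
  have h3 : (L.fst.prod ρ).map Prod.snd = ρ := by
    rw [Measure.map_snd_prod, measure_univ, one_smul]
  rwa [h3] at h2

lemma klDiv_compProd_prod_eq_add (μ π : Measure A) [IsProbabilityMeasure μ] [IsProbabilityMeasure π]
    (κ : Kernel A B) [IsMarkovKernel κ] (ρ : Measure B) [IsProbabilityMeasure ρ] :
    klDiv (μ ⊗ₘ κ) (π.prod ρ) = klDiv μ π + ∫⁻ a, klDiv (κ a) ρ ∂μ := by
  rw [← Measure.compProd_const, klDiv_compProd_eq_add, Measure.compProd_const, klDiv_compProd_prod]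

end Discrete

section Split

variable {𝒳 𝒴 : Type*} [MeasurableSpace 𝒳] [DiscreteMeasurableSpace 𝒳] [Countable 𝒳]
  [MeasurableSpace 𝒴] [DiscreteMeasurableSpace 𝒴] [Countable 𝒴]

lemma iidLaw_singleton (π : Measure (𝒳 × 𝒴)) [IsProbabilityMeasure π] (n : ℕ) (x : Fin n → 𝒳)
    (y : Fin n → 𝒴) : iidLaw π n {(x, y)} = ∏ i, π {(x i, y i)} := by
  rw [iidLaw, Measure.map_apply .of_discrete .of_discrete, ← Measure.pi_singleton]
  congr 1
  ext z
  simp only [Set.mem_preimage, Set.mem_singleton_iff, funext_iff, Prod.ext_iff]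
  exact forall_and.symm

instance (π : Measure (𝒳 × 𝒴)) [IsProbabilityMeasure π] (n : ℕ) :
    IsProbabilityMeasure (iidLaw π n) := Measure.isProbabilityMeasure_map .of_discrete

/-- Splitting a sequence into its head and its tail. -/
def headTail {𝒳 : Type*} {n : ℕ} (x : Fin (n + 1) → 𝒳) : 𝒳 × (Fin n → 𝒳) := (x 0, Fin.tail x)

/-- Splitting a pair of sequences into the pair of heads and the pair of tails. -/
def headTail₂ {𝒳 𝒴 : Type*} {n : ℕ} (z : (Fin (n + 1) → 𝒳) × (Fin (n + 1) → 𝒴)) :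
    (𝒳 × 𝒴) × ((Fin n → 𝒳) × (Fin n → 𝒴)) := ((z.1 0, z.2 0), (Fin.tail z.1, Fin.tail z.2))

lemma headTail_preimage {n : ℕ} (x : 𝒳) (xs : Fin n → 𝒳) :
    headTail ⁻¹' {(x, xs)} = {(Fin.cons x xs : Fin (n + 1) → 𝒳)} := by
  ext z
  simp only [headTail, Set.mem_preimage, Set.mem_singleton_iff, Prod.mk.injEq]
  constructor
  · rintro ⟨rfl, rfl⟩
    exact (Fin.cons_self_tail z).symm
  · rintro rfl
    exact ⟨rfl, rfl⟩

lemma headTail₂_preimage {n : ℕ} (x : 𝒳) (y : 𝒴) (xs : Fin n → 𝒳) (ys : Fin n → 𝒴) :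
    headTail₂ ⁻¹' {((x, y), (xs, ys))} =
      {((Fin.cons x xs : Fin (n + 1) → 𝒳), (Fin.cons y ys : Fin (n + 1) → 𝒴))} := by
  ext ⟨z, z'⟩
  have h1 := Set.ext_iff.1 (headTail_preimage x xs) z
  have h2 := Set.ext_iff.1 (headTail_preimage y ys) z'
  simp only [headTail, headTail₂, Set.mem_preimage, Set.mem_singleton_iff, Prod.mk.injEq] at *
  tauto

lemma iidLaw_map_headTail₂ (π : Measure (𝒳 × 𝒴)) [IsProbabilityMeasure π] (n : ℕ) :
    (iidLaw π (n + 1)).map headTail₂ = π.prod (iidLaw π n) := by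
  refine Measure.ext_of_singleton ?_
  rintro ⟨⟨x, y⟩, ⟨xs, ys⟩⟩
  rw [Measure.map_apply .of_discrete .of_discrete, headTail₂_preimage, iidLaw_singleton,
    ← Set.singleton_prod_singleton, Measure.prod_prod, iidLaw_singleton, Fin.prod_univ_succ]
  simp

/-- The law of the tail given the head. -/
noncomputable def tailKernel {n : ℕ} (Q : Measure (Fin (n + 1) → 𝒳)) [IsProbabilityMeasure Q] :
    Kernel 𝒳 (Fin n → 𝒳) :=
  have : IsProbabilityMeasure (Q.map headTail) := Measure.isProbabilityMeasure_map .of_discrete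
  have : Nonempty (Fin n → 𝒳) := (Q.map headTail).snd.nonempty_of_neZero
  (Q.map headTail).condKernel

instance {n : ℕ} (Q : Measure (Fin (n + 1) → 𝒳)) [IsProbabilityMeasure Q] :
    IsMarkovKernel (tailKernel Q) := by
  unfold tailKernel; infer_instance

lemma tailKernel_mul {n : ℕ} (Q : Measure (Fin (n + 1) → 𝒳)) [IsProbabilityMeasure Q] (x : 𝒳)
    (xs : Fin n → 𝒳) :
    Q.map (fun z => z 0) {x} * tailKernel Q x {xs} = Q {(Fin.cons x xs : Fin (n + 1) → 𝒳)} := by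
  have : IsProbabilityMeasure (Q.map headTail) := Measure.isProbabilityMeasure_map .of_discrete
  have : Nonempty (Fin n → 𝒳) := (Q.map headTail).snd.nonempty_of_neZero
  have hd := (Q.map headTail).disintegrate (Q.map headTail).condKernel
  have hf : (Q.map headTail).fst = Q.map (fun z => z 0) := by
    rw [Measure.fst, Measure.map_map .of_discrete .of_discrete]
    rfl
  rw [← headTail_preimage, ← Measure.map_apply .of_discrete .of_discrete, ← hd, compProd_singleton,
    hf]
  rfl

/-- The two tails remain independent given both heads, each depending only on its own head. Hence
(W, heads) is again a valid common variable for the tails. -/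
lemma prod_map_headTail₂ {n : ℕ} (Q : Measure (Fin (n + 1) → 𝒳)) [IsProbabilityMeasure Q]
    (Q' : Measure (Fin (n + 1) → 𝒴)) [IsProbabilityMeasure Q'] :
    (Q.prod Q').map headTail₂ = ((Q.map fun z => z 0).prod (Q'.map fun z => z 0)) ⊗ₘ
      ((tailKernel Q).comap Prod.fst measurable_fst ×ₖ
        (tailKernel Q').comap Prod.snd measurable_snd) := by
  have : IsProbabilityMeasure (Q.map fun z => z 0) := Measure.isProbabilityMeasure_map .of_discrete
  have : IsProbabilityMeasure (Q'.map fun z => z 0) := Measure.isProbabilityMeasure_map .of_discrete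
  refine Measure.ext_of_singleton ?_
  rintro ⟨⟨x, y⟩, ⟨xs, ys⟩⟩
  rw [Measure.map_apply .of_discrete .of_discrete, headTail₂_preimage, compProd_singleton,
    Kernel.prod_apply, ← Set.singleton_prod_singleton, ← Set.singleton_prod_singleton,
    ← Set.singleton_prod_singleton, Measure.prod_prod, Measure.prod_prod, Measure.prod_prod,
    Kernel.comap_apply, Kernel.comap_apply, ← tailKernel_mul, ← tailKernel_mul]
  ring

end Split

/-- The triple with a countable `W` in any universe. -/
lemma exists_of_countable {𝒳 𝒴 : Type*} [MeasurableSpace 𝒳] [DiscreteMeasurableSpace 𝒳]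
    [Countable 𝒳] [MeasurableSpace 𝒴] [DiscreteMeasurableSpace 𝒴] [Countable 𝒴]
    {W : Type*} [Countable W] [MeasurableSpace W] [DiscreteMeasurableSpace W]
    (PW : Measure W) [IsProbabilityMeasure PW]
    (KX : Kernel W 𝒳) (KY : Kernel W 𝒴) [IsMarkovKernel KX] [IsMarkovKernel KY] :
    ∃ P : MarkovTriple 𝒳 𝒴, P.lawXY = (KX ×ₖ KY) ∘ₘ PW ∧
      P.info = ∫⁻ w, klDiv ((KX ×ₖ KY) w) ((KX ×ₖ KY) ∘ₘ PW) ∂PW := by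
  let _ : MeasurableSpace (Shrink.{0} W) := ⊤
  let e : W ≃ Shrink.{0} W := equivShrink.{0} W
  have he : Measurable e := .of_discrete
  have hes : Measurable e.symm := .of_discrete
  have : IsProbabilityMeasure (PW.map e) := Measure.isProbabilityMeasure_map he.aemeasurable
  obtain ⟨P, h1, h2⟩ := MarkovTriple.exists_of_kernels (PW.map e) (KX.comap e.symm hes)
    (KY.comap e.symm hes)
  have hk : ∀ w, (KX.comap e.symm hes ×ₖ KY.comap e.symm hes) (e w) = (KX ×ₖ KY) w := by
    intro w
    rw [Kernel.prod_apply, Kernel.prod_apply, Kernel.comap_apply, Kernel.comap_apply,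
      e.symm_apply_apply]
  have hlaw : (KX.comap e.symm hes ×ₖ KY.comap e.symm hes) ∘ₘ (PW.map e) = (KX ×ₖ KY) ∘ₘ PW := by
    ext s hs
    rw [Measure.bind_apply hs (Kernel.aemeasurable _), Measure.bind_apply hs (Kernel.aemeasurable _),
      lintegral_map .of_discrete he]
    simp only [hk]
  refine ⟨P, h1.trans hlaw, ?_⟩
  rw [h2, hlaw, lintegral_map .of_discrete he]
  simp only [hk]

/-- By the compensation identity the right side is I + (1+l)D for the block; with the conditional
divergence in place of I, both terms split along the first letter. The first letter is a triple to
which `hK` applies, and the tails form a system of length n with common variable (W, X₁, Y₁). The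
induction therefore ranges over all countable W in a universe closed under this product. -/
theorem nsmul_le_of_system {𝒳 : Type u} {𝒴 : Type v} [MeasurableSpace 𝒳] [DiscreteMeasurableSpace 𝒳]
    [Countable 𝒳] [MeasurableSpace 𝒴] [DiscreteMeasurableSpace 𝒴] [Countable 𝒴]
    (π : Measure (𝒳 × 𝒴)) [IsProbabilityMeasure π] (K l : ℝ≥0∞)
    (hK : ∀ P : MarkovTriple 𝒳 𝒴, K ≤ P.info + (1 + l) * klDiv P.lawXY π) (n : ℕ) :
    ∀ (W : Type (max u v)) [Countable W] [MeasurableSpace W] [DiscreteMeasurableSpace W]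
      (PW : Measure W) [IsProbabilityMeasure PW] (KX : Kernel W (Fin n → 𝒳))
      (KY : Kernel W (Fin n → 𝒴)) [IsMarkovKernel KX] [IsMarkovKernel KY],
      n * K ≤ ∫⁻ w, klDiv ((KX ×ₖ KY) w) (iidLaw π n) ∂PW +
        l * klDiv ((KX ×ₖ KY) ∘ₘ PW) (iidLaw π n) := by
  induction n with
  | zero => intros; simp
  | succ n ih =>
    intro W _ _ _ PW _ KX KY _ _
    have hX0 : Measurable fun x : Fin (n + 1) → 𝒳 => x 0 := .of_discrete
    have hY0 : Measurable fun y : Fin (n + 1) → 𝒴 => y 0 := .of_discrete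
    have : IsMarkovKernel (KX.map fun x => x 0) := Kernel.IsMarkovKernel.map _ hX0
    have : IsMarkovKernel (KY.map fun y => y 0) := Kernel.IsMarkovKernel.map _ hY0
    set K1 := (KX.map fun x => x 0) ×ₖ (KY.map fun y => y 0) with hK1
    obtain ⟨P, hP1, hP2⟩ := exists_of_countable PW (KX.map fun x => x 0) (KY.map fun y => y 0)
    rw [← hK1] at hP1 hP2
    set KX' : Kernel (W × (𝒳 × 𝒴)) (Fin n → 𝒳) :=
      Kernel.ofFunOfCountable fun z => tailKernel (KX z.1) z.2.1
    set KY' : Kernel (W × (𝒳 × 𝒴)) (Fin n → 𝒴) :=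
      Kernel.ofFunOfCountable fun z => tailKernel (KY z.1) z.2.2
    have : IsMarkovKernel KX' := ⟨fun z => inferInstanceAs (IsProbabilityMeasure
      (tailKernel (KX z.1) z.2.1))⟩
    have : IsMarkovKernel KY' := ⟨fun z => inferInstanceAs (IsProbabilityMeasure
      (tailKernel (KY z.1) z.2.2))⟩
    let c : W → Kernel (𝒳 × 𝒴) ((Fin n → 𝒳) × (Fin n → 𝒴)) := fun w =>
      (tailKernel (KX w)).comap Prod.fst measurable_fst ×ₖ
        (tailKernel (KY w)).comap Prod.snd measurable_snd
    have hc : ∀ w z, c w z = (KX' ×ₖ KY') (w, z) := by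
      intro w z
      rw [Kernel.prod_apply, Kernel.prod_apply]
      rfl
    have hcM : ∀ w, IsMarkovKernel (c w) := fun w => inferInstance
    have hsplit : ∀ w, ((KX ×ₖ KY) w).map headTail₂ = K1 w ⊗ₘ c w := by
      intro w
      rw [Kernel.prod_apply, prod_map_headTail₂, hK1, Kernel.prod_apply, Kernel.map_apply _ hX0,
        Kernel.map_apply _ hY0]
    have hpt : ∀ w, klDiv (K1 w) π + ∫⁻ z, klDiv ((KX' ×ₖ KY') (w, z)) (iidLaw π n) ∂K1 w ≤
        klDiv ((KX ×ₖ KY) w) (iidLaw π (n + 1)) := by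
      intro w
      have := klDiv_map_le ((KX ×ₖ KY) w) (iidLaw π (n + 1)) (g := headTail₂) .of_discrete
      rw [hsplit, iidLaw_map_headTail₂, klDiv_compProd_prod_eq_add] at this
      simpa only [hc] using this
    set L := ((KX ×ₖ KY) ∘ₘ PW).map headTail₂ with hL
    have : IsProbabilityMeasure L := Measure.isProbabilityMeasure_map .of_discrete
    have hLapply : ∀ s, L s = ∫⁻ w, (K1 w ⊗ₘ c w) s ∂PW := by
      intro s
      rw [hL, Measure.map_apply .of_discrete .of_discrete,
        Measure.bind_apply .of_discrete (Kernel.aemeasurable _)]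
      refine lintegral_congr fun w => ?_
      rw [← hsplit, Measure.map_apply .of_discrete .of_discrete]
    have hfst : L.fst = K1 ∘ₘ PW := by
      ext s hs
      rw [Measure.fst_apply hs, hLapply, Measure.bind_apply hs (Kernel.aemeasurable _)]
      refine lintegral_congr fun w => ?_
      rw [← Measure.fst_apply hs, Measure.fst_compProd]
    have hsnd : L.snd = (KX' ×ₖ KY') ∘ₘ (PW ⊗ₘ K1) := by
      ext s hs
      rw [Measure.snd_apply hs, hLapply, Measure.bind_apply hs (Kernel.aemeasurable _),
        Measure.lintegral_compProd .of_discrete]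
      refine lintegral_congr fun w => ?_
      rw [← Measure.snd_apply hs, Measure.snd_compProd,
        Measure.bind_apply hs (Kernel.aemeasurable _)]
      simp only [hc]
    have hlaw : klDiv (K1 ∘ₘ PW) π + klDiv ((KX' ×ₖ KY') ∘ₘ (PW ⊗ₘ K1)) (iidLaw π n) ≤
        klDiv ((KX ×ₖ KY) ∘ₘ PW) (iidLaw π (n + 1)) := by
      have h1 := klDiv_map_le ((KX ×ₖ KY) ∘ₘ PW) (iidLaw π (n + 1)) (g := headTail₂) .of_discrete
      rw [iidLaw_map_headTail₂, ← hL] at h1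
      rw [← hfst, ← hsnd]
      exact (klDiv_prod_ge L π (iidLaw π n)).trans h1
    -- Averaging `hpt` over w, the head term becomes information plus divergence of the averaged
    -- head law, by the compensation identity.
    have hint : P.info + klDiv (K1 ∘ₘ PW) π +
        ∫⁻ z, klDiv ((KX' ×ₖ KY') z) (iidLaw π n) ∂(PW ⊗ₘ K1) ≤
        ∫⁻ w, klDiv ((KX ×ₖ KY) w) (iidLaw π (n + 1)) ∂PW := by
      rw [hP2, ← lintegral_klDiv_eq_add, Measure.lintegral_compProd .of_discrete,
        ← lintegral_add_left .of_discrete]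
      exact lintegral_mono hpt
    have hih := ih (W × (𝒳 × 𝒴)) (PW ⊗ₘ K1) KX' KY'
    have hKP := hK P
    rw [hP1] at hKP
    calc ((n + 1 : ℕ) : ℝ≥0∞) * K = K + n * K := by push_cast; ring
      _ ≤ (P.info + (1 + l) * klDiv (K1 ∘ₘ PW) π) +
          (∫⁻ z, klDiv ((KX' ×ₖ KY') z) (iidLaw π n) ∂(PW ⊗ₘ K1) +
            l * klDiv ((KX' ×ₖ KY') ∘ₘ (PW ⊗ₘ K1)) (iidLaw π n)) := add_le_add hKP hih
      _ = (P.info + klDiv (K1 ∘ₘ PW) π +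
          ∫⁻ z, klDiv ((KX' ×ₖ KY') z) (iidLaw π n) ∂(PW ⊗ₘ K1)) +
          l * (klDiv (K1 ∘ₘ PW) π + klDiv ((KX' ×ₖ KY') ∘ₘ (PW ⊗ₘ K1)) (iidLaw π n)) := by ring
      _ ≤ _ := by gcongr

/-! ### The converse -/

section Converse

variable {𝒳 : Type u} {𝒴 : Type v} [MeasurableSpace 𝒳] [DiscreteMeasurableSpace 𝒳]
    [Countable 𝒳] [MeasurableSpace 𝒴] [DiscreteMeasurableSpace 𝒴] [Countable 𝒴]

/-- A code is a system with uniform W. Each conditional law is at most |M| times the average law, so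
the mutual information is at most log|M|. -/
lemma nsmul_le_of_code (π : Measure (𝒳 × 𝒴)) [IsProbabilityMeasure π] (K l : ℝ≥0∞)
    (hK : ∀ P : MarkovTriple 𝒳 𝒴, K ≤ P.info + (1 + l) * klDiv P.lawXY π) {n : ℕ} {R : ℝ}
    (c : FixedLengthCode 𝒳 𝒴 n R) :
    n * K ≤ ENNReal.ofReal (Real.log c.size) + (1 + l) * klDiv c.law (iidLaw π n) := by
  let W := ULift.{max u v} (Fin c.size)
  let _ : MeasurableSpace W := ⊤
  have hM : (c.size : ℝ≥0∞) ≠ 0 := by exact_mod_cast c.size_pos.ne'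
  let PW : Measure W := (c.size : ℝ≥0∞)⁻¹ • Measure.count
  have : IsProbabilityMeasure PW := by
    constructor
    rw [Measure.smul_apply, Measure.count_univ, smul_eq_mul]
    simp only [W, ENat.card_eq_coe_fintype_card, Fintype.card_ulift, Fintype.card_fin,
      ENat.toENNReal_coe]
    exact ENNReal.inv_mul_cancel hM (by simp)
  let KX : Kernel W (Fin n → 𝒳) := Kernel.ofFunOfCountable fun m => c.PX m.down
  let KY : Kernel W (Fin n → 𝒴) := Kernel.ofFunOfCountable fun m => c.PY m.down
  have : IsMarkovKernel KX := ⟨fun m => inferInstanceAs (IsProbabilityMeasure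
    (c.PX m.down : Measure (Fin n → 𝒳)))⟩
  have : IsMarkovKernel KY := ⟨fun m => inferInstanceAs (IsProbabilityMeasure
    (c.PY m.down : Measure (Fin n → 𝒴)))⟩
  have hint : ∀ f : W → ℝ≥0∞, ∫⁻ m, f m ∂PW = (c.size : ℝ≥0∞)⁻¹ * ∑ m, f (ULift.up m) := by
    intro f
    rw [lintegral_smul_measure, lintegral_count, tsum_fintype, smul_eq_mul]
    congr 1
    exact (Equiv.sum_comp Equiv.ulift.symm f).symm
  have hlaw : (KX ×ₖ KY) ∘ₘ PW = c.law := by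
    ext s hs
    rw [Measure.bind_apply hs (Kernel.aemeasurable _), hint, FixedLengthCode.law,
      Measure.smul_apply, Measure.finsetSum_apply, smul_eq_mul]
    simp only [Kernel.prod_apply]
    rfl
  have hL : IsProbabilityMeasure c.law := by rw [← hlaw]; infer_instance
  have h1 := nsmul_le_of_system π K l hK n W PW KX KY
  rw [lintegral_klDiv_eq_add, hlaw] at h1
  have h2 : ∫⁻ m, klDiv ((KX ×ₖ KY) m) c.law ∂PW ≤ ENNReal.ofReal (Real.log c.size) := by
    calc ∫⁻ m, klDiv ((KX ×ₖ KY) m) c.law ∂PW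
        ≤ ∫⁻ _, ENNReal.ofReal (Real.log c.size) ∂PW := by
          refine lintegral_mono fun m => ?_
          have := klDiv_le_add_log ((KX ×ₖ KY) m) ((KX ×ₖ KY) m) c.law c.size
            (by exact_mod_cast c.size_pos) ?_
          · simpa using this
          · intro a
            rw [← hlaw, Measure.bind_apply (measurableSet_singleton a) (Kernel.aemeasurable _), hint,
              ENNReal.ofReal_natCast, ← mul_assoc, ENNReal.mul_inv_cancel hM (by simp), one_mul]
            exact Finset.single_le_sum (f := fun i => (KX ×ₖ KY) (ULift.up i) {a})
              (fun _ _ => zero_le) (Finset.mem_univ m.down)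
      _ = _ := by simp
  calc n * K ≤ _ := h1
    _ ≤ (ENNReal.ofReal (Real.log c.size) + klDiv c.law (iidLaw π n)) +
        l * klDiv c.law (iidLaw π n) := by gcongr
    _ = _ := by ring

lemma le_rate_of_codes (π : Measure (𝒳 × 𝒴)) [IsProbabilityMeasure π] (K : ℝ≥0∞) (l R : ℝ≥0)
    (hK : ∀ P : MarkovTriple 𝒳 𝒴, K ≤ P.info + (1 + l) * klDiv P.lawXY π)
    (c : (n : ℕ) → FixedLengthCode 𝒳 𝒴 n R)
    (hc : Tendsto (fun n => klDiv (c n).law (iidLaw π n) / (n : ℝ≥0∞)) atTop (𝓝 0)) : K ≤ R := by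
  have h1 : Tendsto (fun n => (R : ℝ≥0∞) + (1 + l) * (klDiv (c n).law (iidLaw π n) / (n : ℝ≥0∞)))
      atTop (𝓝 (R + (1 + l) * 0)) :=
    (ENNReal.Tendsto.const_mul hc (Or.inr (by simp))).const_add _
  rw [mul_zero, add_zero] at h1
  refine ge_of_tendsto h1 ?_
  filter_upwards [eventually_gt_atTop 0] with n hn
  have hn0 : (n : ℝ≥0∞) ≠ 0 := by exact_mod_cast hn.ne'
  have hnt : (n : ℝ≥0∞) ≠ ∞ := ENNReal.natCast_ne_top n
  have h2 := nsmul_le_of_code π K l hK (c n)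
  have h3 : ENNReal.ofReal (Real.log (c n).size) ≤ n * R := by
    have := (c n).rate_le
    rw [div_le_iff₀ (by exact_mod_cast hn)] at this
    refine (ENNReal.ofReal_le_ofReal this).trans_eq ?_
    rw [ENNReal.ofReal_mul (NNReal.coe_nonneg R), ENNReal.ofReal_coe_nnreal, ENNReal.ofReal_natCast,
      mul_comm]
  rw [← ENNReal.mul_le_mul_iff_right hn0 hnt]
  calc (n : ℝ≥0∞) * K ≤ n * R + (1 + l) * klDiv (c n).law (iidLaw π n) := h2.trans (by gcongr)
    _ = n * R + (1 + l) * (n * (klDiv (c n).law (iidLaw π n) / n)) := by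
        rw [ENNReal.mul_div_cancel hn0 hnt]
    _ = _ := by ring

lemma relaxedWynerCI_le_rate (π : Measure (𝒳 × 𝒴)) [IsProbabilityMeasure π] (R : ℝ≥0)
    (c : (n : ℕ) → FixedLengthCode 𝒳 𝒴 n R)
    (hc : Tendsto (fun n => klDiv (c n).law (iidLaw π n) / (n : ℝ≥0∞)) atTop (𝓝 0))
    {ε : ℝ≥0} (hε : 0 < ε) : relaxedWynerCI π ε ≤ R := by
  refine ENNReal.le_of_forall_pos_le_add fun δ hδ _ => ?_
  -- With this multiplier a triple of divergence above ε has penalty at least lε = R + δ, so a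
  -- triple whose Lagrangian is below R + δ is admissible for ε.
  set l : ℝ≥0 := (R + δ) / ε with hl
  have h1 := le_rate_of_codes π (⨅ P : MarkovTriple 𝒳 𝒴, P.info + (1 + (l : ℝ≥0∞)) *
    klDiv P.lawXY π) l R (fun P => iInf_le _ P) c hc
  have h2 : (R : ℝ≥0∞) < R + δ := by
    exact_mod_cast lt_add_of_pos_right R hδ
  obtain ⟨P, hP⟩ := iInf_lt_iff.1 (h1.trans_lt h2)
  refine (iInf₂_le P ?_).trans (le_self_add.trans hP.le)
  by_contra! h
  refine absurd hP (not_lt.2 ?_)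
  have h3 : (R : ℝ≥0∞) + δ = l * ε := by
    rw [hl, ← ENNReal.coe_mul, div_mul_cancel₀ _ hε.ne', ENNReal.coe_add]
  rw [h3]
  calc (l : ℝ≥0∞) * ε ≤ (1 + l) * klDiv P.lawXY π := mul_le_mul' le_add_self h.le
    _ ≤ _ := le_add_self

lemma wynerCI_le_normalizedT1 (π : Measure (𝒳 × 𝒴)) [IsProbabilityMeasure π]
    (h : Tendsto (relaxedWynerCI π) (𝓝[>] 0) (𝓝 (wynerCI π))) : wynerCI π ≤ normalizedT1 π := by
  refine le_iInf₂ fun R ⟨c, hc⟩ => ?_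
  refine le_of_tendsto h ?_
  have : ∀ᶠ ε : ℝ≥0∞ in 𝓝[>] 0, ε < ∞ :=
    eventually_nhdsWithin_of_eventually_nhds (eventually_lt_nhds ENNReal.zero_lt_top)
  filter_upwards [this, self_mem_nhdsWithin] with ε hε hε0
  lift ε to ℝ≥0 using hε.ne
  exact relaxedWynerCI_le_rate π R c hc (ENNReal.coe_pos.1 hε0)

lemma normalizedT1_le_T1 (π : Measure (𝒳 × 𝒴)) : normalizedT1 π ≤ T1 π := by
  refine le_iInf₂ fun R ⟨c, hc⟩ => iInf₂_le R ⟨c, ?_⟩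
  refine tendsto_of_tendsto_of_tendsto_of_le_of_le' tendsto_const_nhds hc
    (Eventually.of_forall fun _ => zero_le) ?_
  filter_upwards [eventually_gt_atTop 0] with n hn
  refine ENNReal.div_le_of_le_mul ?_
  have : (1 : ℝ≥0∞) ≤ n := by exact_mod_cast hn
  calc _ = klDiv (c n).law (iidLaw π n) * 1 := (mul_one _).symm
    _ ≤ _ := by gcongr

end Converse

/-! ### Moments of averages of independent variables -/

section Moments

variable {Ω : Type*} [MeasurableSpace Ω] (P : Measure Ω) [IsProbabilityMeasure P]

lemma lintegral_pi_prod {n : ℕ} (f : Fin n → Ω → ℝ≥0∞) (hf : ∀ i, Measurable (f i)) :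
    ∫⁻ x, ∏ i, f i (x i) ∂(Measure.pi fun _ : Fin n => P) = ∏ i, ∫⁻ x, f i x ∂P := by
  have h := lintegral_prod_eq_prod_lintegral_of_indepFun (μ := Measure.pi fun _ : Fin n => P)
    Finset.univ (fun i x => f i (x i)) (iIndepFun_pi fun i => (hf i).aemeasurable)
    fun i => (hf i).comp (measurable_pi_apply i)
  refine h.trans ?_
  refine Finset.prod_congr rfl fun i _ => ?_
  exact (measurePreserving_eval (fun _ : Fin n => P) i).lintegral_comp (hf i)

/-- Weighted AM-GM with 1. This tangent bound makes the cross terms below linear, so that pairwise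
independence evaluates them. -/
lemma rpow_le_one_sub_add_mul (x : ℝ≥0∞) {s : ℝ} (hs : 0 < s) (hs1 : s ≤ 1) :
    x ^ s ≤ ENNReal.ofReal (1 - s) + ENNReal.ofReal s * x := by
  by_cases hx : x = ∞
  · rw [hx, ENNReal.mul_top (by simpa using hs)]
    simp
  lift x to ℝ≥0 using hx
  have := Real.geom_mean_le_arith_mean2_weighted (sub_nonneg.2 hs1) hs.le zero_le_one
    (NNReal.coe_nonneg x) (by ring)
  rw [Real.one_rpow, one_mul, mul_one] at this
  rw [← ENNReal.ofReal_coe_nnreal, ENNReal.ofReal_rpow_of_nonneg (NNReal.coe_nonneg x) hs.le,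
    ← ENNReal.ofReal_mul hs.le, ← ENNReal.ofReal_add (sub_nonneg.2 hs1) (by positivity)]
  exact ENNReal.ofReal_le_ofReal this

/-- Moments of an average of independent variables of mean one. -/
lemma lintegral_avg_rpow_le {U : Ω → ℝ≥0∞} (hU : Measurable U) (hU1 : ∫⁻ x, U x ∂P = 1)
    {M : ℕ} (hM : 0 < M) {s : ℝ} (hs : 0 < s) (hs1 : s ≤ 1) :
    ∫⁻ c, ((M : ℝ≥0∞)⁻¹ * ∑ m, U (c m)) ^ (1 + s) ∂(Measure.pi fun _ : Fin M => P) ≤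
      1 + (M : ℝ≥0∞)⁻¹ ^ s * ∫⁻ x, U x ^ (1 + s) ∂P := by
  set a : ℝ≥0∞ := (M : ℝ≥0∞)⁻¹ with ha
  have hM0 : (M : ℝ≥0∞) ≠ 0 := by exact_mod_cast hM.ne'
  have haM : (M : ℝ≥0∞) * a = 1 := ENNReal.mul_inv_cancel hM0 (by simp)
  set Q := Measure.pi fun _ : Fin M => P with hQ
  have hUm : ∀ m : Fin M, Measurable fun c : Fin M → Ω => U (c m) :=
    fun m => hU.comp (measurable_pi_apply m)
  have hev : ∀ (m : Fin M) (f : Ω → ℝ≥0∞), Measurable f → ∫⁻ c, f (c m) ∂Q = ∫⁻ x, f x ∂P :=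
    fun m f hf => (measurePreserving_eval (fun _ : Fin M => P) m).lintegral_comp hf
  have hpair : ∀ m m' : Fin M, m ≠ m' → ∫⁻ c, U (c m) * U (c m') ∂Q = 1 := by
    intro m m' hne
    have hi := (iIndepFun_pi (μ := fun _ : Fin M => P) (X := fun _ => U)
      fun i => hU.aemeasurable).indepFun hne
    have := lintegral_mul_eq_lintegral_mul_lintegral_of_indepFun'' (hUm m).aemeasurable
      (hUm m').aemeasurable hi
    rw [this, hev m U hU, hev m' U hU, hU1, one_mul]
  -- One factor of the average is expanded over m. In the remaining s-th power the m-th summand is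
  -- separated by subadditivity of x^s, and the other summands are linearized.
  have hpt : ∀ c : Fin M → Ω, (a * ∑ m, U (c m)) ^ (1 + s) ≤
      ∑ m, (a * a ^ s * U (c m) ^ (1 + s) + a * ENNReal.ofReal (1 - s) * U (c m) +
        a * ENNReal.ofReal s * a * ∑ m' ∈ Finset.univ.erase m, U (c m) * U (c m')) := by
    intro c
    rw [ENNReal.rpow_add_of_nonneg _ _ zero_le_one hs.le, ENNReal.rpow_one]
    nth_rewrite 1 [Finset.mul_sum]
    rw [Finset.sum_mul]
    refine Finset.sum_le_sum fun m _ => ?_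
    have h1 : a * ∑ m', U (c m') = a * U (c m) + a * ∑ m' ∈ Finset.univ.erase m, U (c m') := by
      rw [← mul_add, Finset.add_sum_erase _ (fun m' => U (c m')) (Finset.mem_univ m)]
    rw [h1]
    calc a * U (c m) * (a * U (c m) + a * ∑ m' ∈ Finset.univ.erase m, U (c m')) ^ s
        ≤ a * U (c m) * ((a * U (c m)) ^ s + (ENNReal.ofReal (1 - s) +
          ENNReal.ofReal s * (a * ∑ m' ∈ Finset.univ.erase m, U (c m')))) := by
          gcongr
          exact (ENNReal.rpow_add_le_add_rpow _ _ hs.le hs1).trans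
            (add_le_add le_rfl (rpow_le_one_sub_add_mul _ hs hs1))
      _ = _ := by
          rw [ENNReal.mul_rpow_of_nonneg _ _ hs.le, ENNReal.rpow_add_of_nonneg _ _ zero_le_one hs.le,
            ENNReal.rpow_one, ← Finset.mul_sum]
          ring
  refine (lintegral_mono hpt).trans ?_
  rw [lintegral_finsetSum _ fun m _ => by fun_prop]
  have hterm : ∀ m : Fin M, ∫⁻ c, (a * a ^ s * U (c m) ^ (1 + s) + a * ENNReal.ofReal (1 - s) * U (c m) +
        a * ENNReal.ofReal s * a * ∑ m' ∈ Finset.univ.erase m, U (c m) * U (c m')) ∂Q ≤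
      a * (a ^ s * ∫⁻ x, U x ^ (1 + s) ∂P + 1) := by
    intro m
    rw [lintegral_add_left (by fun_prop), lintegral_add_left (by fun_prop),
      lintegral_const_mul _ (by fun_prop), lintegral_const_mul _ (by fun_prop),
      lintegral_const_mul _ (by fun_prop), hev m U hU, hU1,
      hev m (fun x => U x ^ (1 + s)) (by fun_prop), lintegral_finsetSum _ fun m _ => by fun_prop,
      Finset.sum_congr rfl fun m' hm' => hpair m m' (Finset.ne_of_mem_erase hm').symm]
    -- Each cross term has mean 1, so the M - 1 of them with weight 1/M contribute at most 1.
    have hcard : a * ∑ _m' ∈ Finset.univ.erase m, (1 : ℝ≥0∞) ≤ 1 := by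
      rw [mul_comm, Finset.sum_const, nsmul_eq_mul, mul_one]
      refine le_trans ?_ haM.le
      gcongr
      exact (Finset.card_le_univ _).trans_eq (Fintype.card_fin M)
    calc _ = a * (a ^ s * ∫⁻ x, U x ^ (1 + s) ∂P + (ENNReal.ofReal (1 - s) +
        ENNReal.ofReal s * (a * ∑ _m' ∈ Finset.univ.erase m, (1 : ℝ≥0∞)))) := by ring
      _ ≤ a * (a ^ s * ∫⁻ x, U x ^ (1 + s) ∂P + (ENNReal.ofReal (1 - s) +
        ENNReal.ofReal s * 1)) := by gcongr
      _ = _ := by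
        rw [mul_one, ← ENNReal.ofReal_add (sub_nonneg.2 hs1) hs.le]
        simp
  calc _ ≤ ∑ _m : Fin M, a * (a ^ s * ∫⁻ x, U x ^ (1 + s) ∂P + 1) :=
        Finset.sum_le_sum fun m _ => hterm m
    _ = _ := by
      rw [Finset.sum_const, Finset.card_univ, Fintype.card_fin, nsmul_eq_mul, ← mul_assoc, haM,
        one_mul, add_comm]

end Moments

/-! ### One-shot soft covering -/

section SoftCovering

variable {A : Type*} [MeasurableSpace A] [DiscreteMeasurableSpace A] [Countable A]

/-- This is 1 + s log x ≤ x^s multiplied by x, arranged so that both sides are nonnegative. -/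
lemma mul_klFun_add_le {x s : ℝ} (hx : 0 ≤ x) (hs : 0 < s) :
    s * klFun x + (1 + s) * x ≤ x ^ (1 + s) + s := by
  rcases hx.eq_or_lt with rfl | hx
  · rw [klFun_zero, Real.zero_rpow (by linarith)]; linarith
  have h1 : 1 + s * Real.log x ≤ x ^ s := by
    rw [Real.rpow_def_of_pos hx]
    have := Real.add_one_le_exp (Real.log x * s)
    linarith
  rw [Real.rpow_add hx, Real.rpow_one, klFun_apply]
  nlinarith [mul_le_mul_of_nonneg_left h1 hx.le]

/-- Integrating `mul_klFun_add_le` leaves 1 + s on the left and s on the right. The lemma lets a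
moment, which averages well over codebooks, control the divergence. -/
lemma mul_klDiv_add_one_le (L q : Measure A) [IsProbabilityMeasure L] [IsProbabilityMeasure q]
    (h : L ≪ q) {s : ℝ} (hs : 0 < s) :
    ENNReal.ofReal s * klDiv L q + 1 ≤ ∫⁻ z, ratio L q z ^ (1 + s) ∂q := by
  have key : ∫⁻ z, (ENNReal.ofReal s * ENNReal.ofReal (klFun (ratio L q z).toReal) +
      ENNReal.ofReal (1 + s) * ratio L q z) ∂q ≤
      ∫⁻ z, (ratio L q z ^ (1 + s) + ENNReal.ofReal s) ∂q := by
    refine lintegral_mono_ae ?_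
    filter_upwards [ae_measure_singleton_ne_zero q] with z hz
    have h0 : 0 ≤ (ratio L q z).toReal := ENNReal.toReal_nonneg
    have hk := klFun_nonneg h0
    rw [← ENNReal.ofReal_toReal (ratio_ne_top L q hz), ENNReal.toReal_ofReal h0,
      ENNReal.ofReal_rpow_of_nonneg h0 (by positivity), ← ENNReal.ofReal_mul hs.le,
      ← ENNReal.ofReal_mul (by positivity), ← ENNReal.ofReal_add (by positivity) (by positivity),
      ← ENNReal.ofReal_add (by positivity) hs.le]
    exact ENNReal.ofReal_le_ofReal (mul_klFun_add_le h0 hs)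
  rw [lintegral_add_left .of_discrete, lintegral_add_left .of_discrete,
    lintegral_const_mul _ .of_discrete, lintegral_const_mul _ .of_discrete, lintegral_ratio _ _ h,
    ← klDiv_eq_lintegral_ratio _ _ h, lintegral_const, measure_univ, measure_univ, mul_one, mul_one,
    ENNReal.ofReal_add zero_le_one hs.le, ENNReal.ofReal_one, ← add_assoc,
    ENNReal.add_le_add_iff_right ENNReal.ofReal_ne_top] at key
  exact key

variable {W : Type*} [MeasurableSpace W] (PW : Measure W) [IsProbabilityMeasure PW]
  (κ : Kernel W A) [IsMarkovKernel κ]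

lemma ae_ac_bind : ∀ᵐ w ∂PW, κ w ≪ κ ∘ₘ PW := by
  refine ae_ac_of_singleton fun a ha => ?_
  rw [Measure.bind_apply .of_discrete κ.aemeasurable,
    lintegral_eq_zero_iff (κ.measurable_coe .of_discrete)] at ha
  exact ha

lemma lintegral_ratio_kernel {z : A} (hz : (κ ∘ₘ PW) {z} ≠ 0) :
    ∫⁻ w, ratio (κ w) (κ ∘ₘ PW) z ∂PW = 1 := by
  simp only [ratio, div_eq_mul_inv]
  rw [lintegral_mul_const _ (κ.measurable_coe .of_discrete),
    ← Measure.bind_apply .of_discrete κ.aemeasurable,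
    ENNReal.mul_inv_cancel hz (measure_ne_top _ _)]

/-- The exponential moment `E exp(s i(W; Z))` of the information density. -/
noncomputable def infoMoment (s : ℝ) : ℝ≥0∞ :=
  ∫⁻ z, ∫⁻ w, ratio (κ w) (κ ∘ₘ PW) z ^ (1 + s) ∂PW ∂(κ ∘ₘ PW)

/-- One-shot soft covering. -/
theorem exists_codebook {M : ℕ} (hM : 0 < M) {s : ℝ} (hs : 0 < s) (hs1 : s ≤ 1) :
    ∃ c : Fin M → W, ENNReal.ofReal s * klDiv ((M : ℝ≥0∞)⁻¹ • ∑ m, κ (c m)) (κ ∘ₘ PW) ≤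
      (M : ℝ≥0∞)⁻¹ ^ s * infoMoment PW κ s := by
  set q := κ ∘ₘ PW with hq
  have hM0 : (M : ℝ≥0∞) ≠ 0 := by exact_mod_cast hM.ne'
  have hmeas := measurable_ratio_kernel κ q
  have hm2 : Measurable fun p : (Fin M → W) × A =>
      ((M : ℝ≥0∞)⁻¹ * ∑ m, ratio (κ (p.1 m)) q p.2) ^ (1 + s) := by
    refine (Measurable.const_mul (Finset.measurable_fun_sum _ fun m _ => ?_) _).pow_const _
    have : Measurable fun p : (Fin M → W) × A => (p.1 m, p.2) := by fun_prop
    exact hmeas.comp this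
  set G : (Fin M → W) → ℝ≥0∞ := fun c =>
    ∫⁻ z, ((M : ℝ≥0∞)⁻¹ * ∑ m, ratio (κ (c m)) q z) ^ (1 + s) ∂q with hG
  have hGm : Measurable G := hm2.lintegral_prod_right'
  have hGint : ∫⁻ c, G c ∂(Measure.pi fun _ : Fin M => PW) ≤
      1 + (M : ℝ≥0∞)⁻¹ ^ s * infoMoment PW κ s := by
    rw [hG, lintegral_lintegral_swap hm2.aemeasurable]
    calc _ ≤ ∫⁻ z, (1 + (M : ℝ≥0∞)⁻¹ ^ s * ∫⁻ w, ratio (κ w) q z ^ (1 + s) ∂PW) ∂q := by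
          refine lintegral_mono_ae ?_
          filter_upwards [ae_measure_singleton_ne_zero q] with z hz
          exact lintegral_avg_rpow_le PW (hmeas.comp measurable_prodMk_right)
            (lintegral_ratio_kernel PW κ hz) hM hs hs1
      _ = _ := by
          rw [lintegral_add_left .of_discrete, lintegral_const_mul _ .of_discrete]
          simp [infoMoment, hq]
  have hae : ∀ᵐ c ∂(Measure.pi fun _ : Fin M => PW), ∀ m, κ (c m) ≪ q := by
    rw [ae_all_iff]
    intro m
    exact (measurePreserving_eval (fun _ : Fin M => PW) m).quasiMeasurePreserving.ae (ae_ac_bind PW κ)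
  -- Some codebook is no worse than the mean and also avoids the null set of codewords whose output
  -- law is not absolutely continuous.
  obtain ⟨c, hc, hcG⟩ := exists_notMem_null_le_lintegral hGm.aemeasurable (ae_iff.1 hae)
  have hc' : ∀ m, κ (c m) ≪ q := not_not.1 hc
  refine ⟨c, ?_⟩
  set L : Measure A := (M : ℝ≥0∞)⁻¹ • ∑ m, κ (c m) with hL
  have hLa : ∀ z, L {z} = (M : ℝ≥0∞)⁻¹ * ∑ m, κ (c m) {z} := by
    intro z
    rw [hL, Measure.smul_apply, Measure.finsetSum_apply, smul_eq_mul]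
  have hprob : IsProbabilityMeasure L := by
    constructor
    rw [hL, Measure.smul_apply, Measure.finsetSum_apply]
    simp [ENNReal.inv_mul_cancel hM0]
  have hac : L ≪ q := by
    refine ac_of_singleton fun z hz => ?_
    rw [hLa, Finset.sum_eq_zero fun m _ => hc' m hz, mul_zero]
  have h1 := mul_klDiv_add_one_le L q hac hs
  have hGc : ∫⁻ z, ratio L q z ^ (1 + s) ∂q = G c := by
    refine lintegral_congr fun z => ?_
    simp only [ratio, hLa, div_eq_mul_inv, Finset.sum_mul, mul_assoc]
  rw [hGc] at h1
  have h2 := h1.trans (hcG.trans hGint)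
  rw [add_comm] at h2
  exact (ENNReal.add_le_add_iff_left ENNReal.one_ne_top).1 h2

end SoftCovering

/-! ### The moment of the information density near s = 0 -/

section MomentLimit

/-- The function `s ↦ (x^(1+s) - x)/s + 1 - x` decreases to `klFun x` as `s ↓ 0`. -/
noncomputable def powFun (s x : ℝ) : ℝ := (x ^ (1 + s) - x) / s + 1 - x

lemma klFun_le_powFun {s x : ℝ} (hs : 0 < s) (hx : 0 ≤ x) : klFun x ≤ powFun s x := by
  have h := mul_klFun_add_le hx hs
  have h1 : klFun x = (s * klFun x + s * x - s) / s + 1 - x := by field_simp; ring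
  have h2 := div_le_div_of_nonneg_right
    (by linarith : s * klFun x + s * x - s ≤ x ^ (1 + s) - x) hs.le
  rw [powFun]
  linarith

lemma powFun_mono {s t x : ℝ} (hs : 0 < s) (hst : s ≤ t) (hx : 0 ≤ x) : powFun s x ≤ powFun t x := by
  have ht : 0 < t := hs.trans_le hst
  rcases hx.eq_or_lt with rfl | hx
  · simp [powFun, Real.zero_rpow (by linarith : (1 + s) ≠ 0), Real.zero_rpow (by linarith : (1 + t) ≠ 0)]
  -- Bernoulli's inequality for (1 + (x^s - 1))^(t/s), with exponent t/s ≥ 1.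
  have h1 : 1 + t / s * (x ^ s - 1) ≤ x ^ t := by
    have := one_add_mul_self_le_rpow_one_add (s := x ^ s - 1)
      (by have := Real.rpow_nonneg hx.le s; linarith) ((one_le_div hs).2 hst)
    rwa [add_sub_cancel, ← Real.rpow_mul hx.le, mul_div_cancel₀ _ hs.ne'] at this
  suffices h : (x ^ (1 + s) - x) / s ≤ (x ^ (1 + t) - x) / t by
    unfold powFun
    linarith
  rw [Real.rpow_add hx, Real.rpow_add hx, Real.rpow_one, div_le_div_iff₀ hs ht]
  have h2 : s * (t / s * (x ^ s - 1)) = t * (x ^ s - 1) := by field_simp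
  have h3 : t * (x ^ s - 1) ≤ s * (x ^ t - 1) := by
    rw [← h2]
    exact mul_le_mul_of_nonneg_left (by linarith) hs.le
  nlinarith [mul_le_mul_of_nonneg_left h3 hx.le]

lemma tendsto_powFun {x : ℝ} (hx : 0 ≤ x) :
    Tendsto (fun s => powFun s x) (𝓝[>] 0) (𝓝 (klFun x)) := by
  rcases hx.eq_or_lt with rfl | hx
  · rw [klFun_zero]
    refine tendsto_const_nhds.congr' ?_
    filter_upwards [self_mem_nhdsWithin] with s hs
    have : (1 + s) ≠ 0 := by have : 0 < s := hs; linarith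
    simp [powFun, Real.zero_rpow this]
  have h1 : HasDerivAt (fun s : ℝ => x ^ s) (Real.log x) 0 := by
    simpa using (Real.hasStrictDerivAt_const_rpow hx 0).hasDerivAt
  have h2 := (hasDerivAt_iff_tendsto_slope_zero.1 h1).mono_left
    (nhdsWithin_mono 0 fun s (hs : 0 < s) => hs.ne')
  have h3 := ((h2.const_mul x).add_const 1).sub_const x
  rw [klFun_apply]
  refine h3.congr' ?_
  filter_upwards [self_mem_nhdsWithin] with s hs
  have hs' : s ≠ 0 := (show 0 < s from hs).ne'
  rw [powFun, Real.rpow_add hx 1 s, Real.rpow_one, zero_add, Real.rpow_zero, smul_eq_mul]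
  field_simp

variable {A : Type*} [MeasurableSpace A] [DiscreteMeasurableSpace A] [Countable A]
  {W : Type*} [MeasurableSpace W] (PW : Measure W) [IsProbabilityMeasure PW]
  (κ : Kernel W A) [IsMarkovKernel κ]

/-- The likelihood ratio at z is at most 1/q(z), where q is the output law, and has mean 1 over W.
The bound depends on q alone, so the Rényi hypothesis on π serves every triple with law π. -/
lemma infoMoment_le {s : ℝ} (hs : 0 < s) :
    infoMoment PW κ s ≤ ∫⁻ z, (κ ∘ₘ PW) {z} ^ (-s) ∂(κ ∘ₘ PW) := by
  refine lintegral_mono_ae ?_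
  filter_upwards [ae_measure_singleton_ne_zero (κ ∘ₘ PW)] with z hz
  have hm : Measurable fun w => ratio (κ w) (κ ∘ₘ PW) z :=
    (measurable_ratio_kernel κ (κ ∘ₘ PW)).comp measurable_prodMk_right
  calc ∫⁻ w, ratio (κ w) (κ ∘ₘ PW) z ^ (1 + s) ∂PW
      ≤ ∫⁻ w, ratio (κ w) (κ ∘ₘ PW) z * (κ ∘ₘ PW) {z} ^ (-s) ∂PW := by
        refine lintegral_mono fun w => ?_
        rw [ENNReal.rpow_add_of_nonneg _ _ zero_le_one hs.le, ENNReal.rpow_one, ENNReal.rpow_neg,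
          ← ENNReal.inv_rpow]
        gcongr
        rw [ratio, div_eq_mul_inv]
        exact mul_le_of_le_one_left zero_le prob_le_one
    _ = _ := by
        rw [lintegral_mul_const _ hm, lintegral_ratio_kernel PW κ hz, one_mul]

/-- Because the likelihood ratio has mean 1, (B(s) - 1)/s is the integral of `powFun s`, which tends
to the mutual information as s ↓ 0 by dominated convergence, with `powFun s₀` as dominating
function. -/
lemma exists_infoMoment_le {s₀ : ℝ} (hs₀ : 0 < s₀) (h : infoMoment PW κ s₀ ≠ ∞) {R : ℝ≥0∞}
    (hR : ∫⁻ w, klDiv (κ w) (κ ∘ₘ PW) ∂PW < R) :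
    ∃ s, 0 < s ∧ s ≤ s₀ ∧ infoMoment PW κ s ≤ 1 + ENNReal.ofReal s * R := by
  set q := κ ∘ₘ PW with hq
  set Q := PW.prod q with hQ
  set l : W × A → ℝ≥0∞ := fun p => ratio (κ p.1) q p.2 with hl
  have hlm : Measurable l := measurable_ratio_kernel κ q
  have hB : ∀ s, infoMoment PW κ s = ∫⁻ p, l p ^ (1 + s) ∂Q := by
    intro s
    rw [hQ, lintegral_prod_symm' _ (hlm.pow_const _)]
    rfl
  have hl1 : ∫⁻ p, l p ∂Q = 1 := by
    rw [hQ, lintegral_prod _ hlm.aemeasurable]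
    have : ∀ᵐ w ∂PW, ∫⁻ z, l (w, z) ∂q = 1 := by
      filter_upwards [ae_ac_bind PW κ] with w hw
      exact (lintegral_ratio _ _ hw).trans measure_univ
    rw [lintegral_congr_ae this]
    simp
  have hlt : ∀ᵐ p ∂Q, l p ≠ ∞ := by
    have := (Measure.quasiMeasurePreserving_snd (μ := PW) (ν := q)).ae (ae_measure_singleton_ne_zero q)
    filter_upwards [this] with p hp using ratio_ne_top _ _ hp
  have hpm : ∀ s, Measurable fun p => ENNReal.ofReal (powFun s (l p).toReal) := by
    intro s
    unfold powFun
    have := hlm.ennreal_toReal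
    fun_prop
  have hI : ∫⁻ w, klDiv (κ w) q ∂PW = ∫⁻ p, ENNReal.ofReal (klFun (l p).toReal) ∂Q := by
    rw [← klDiv_compProd_prod, compProd_eq_withDensity PW κ q (ae_ac_bind PW κ)]
    have : IsFiniteMeasure ((PW.prod q).withDensity l) := by
      rw [← compProd_eq_withDensity PW κ q (ae_ac_bind PW κ)]; infer_instance
    exact klDiv_withDensity _ hlm
  have hid : ∀ s, 0 < s → ENNReal.ofReal s * ∫⁻ p, ENNReal.ofReal (powFun s (l p).toReal) ∂Q + 1 =
      infoMoment PW κ s := by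
    intro s hs
    have h1 : ∫⁻ p, (ENNReal.ofReal s * ENNReal.ofReal (powFun s (l p).toReal) +
        ENNReal.ofReal (1 + s) * l p) ∂Q = ∫⁻ p, (l p ^ (1 + s) + ENNReal.ofReal s) ∂Q := by
      refine lintegral_congr_ae ?_
      filter_upwards [hlt] with p hp
      have h0 : 0 ≤ (l p).toReal := ENNReal.toReal_nonneg
      have hk := (klFun_nonneg h0).trans (klFun_le_powFun hs h0)
      rw [← ENNReal.ofReal_toReal hp, ENNReal.toReal_ofReal h0,
        ENNReal.ofReal_rpow_of_nonneg h0 (by positivity), ← ENNReal.ofReal_mul hs.le,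
        ← ENNReal.ofReal_mul (by positivity), ← ENNReal.ofReal_add (by positivity) (by positivity),
        ← ENNReal.ofReal_add (by positivity) hs.le]
      congr 1
      rw [powFun]
      field_simp
      ring
    rw [lintegral_add_left ((hpm s).const_mul _), lintegral_add_left (hlm.pow_const _),
      lintegral_const_mul _ (hpm s), lintegral_const_mul _ hlm, hl1, lintegral_const, measure_univ,
      mul_one, mul_one, ← hB, ENNReal.ofReal_add zero_le_one hs.le, ENNReal.ofReal_one,
      ← add_assoc] at h1
    exact (ENNReal.add_left_inj ENNReal.ofReal_ne_top).1 h1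
  have hbound : ∫⁻ p, ENNReal.ofReal (powFun s₀ (l p).toReal) ∂Q ≠ ∞ := by
    intro htop
    have := hid s₀ hs₀
    rw [htop, ENNReal.mul_top (by simpa using hs₀)] at this
    exact h (by rw [← this]; simp)
  have hlim : Tendsto (fun s => ∫⁻ p, ENNReal.ofReal (powFun s (l p).toReal) ∂Q) (𝓝[>] 0)
      (𝓝 (∫⁻ p, ENNReal.ofReal (klFun (l p).toReal) ∂Q)) := by
    refine tendsto_lintegral_filter_of_dominated_convergence _ (Eventually.of_forall hpm) ?_ hbound
      (Eventually.of_forall fun p => ENNReal.tendsto_ofReal (tendsto_powFun ENNReal.toReal_nonneg))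
    filter_upwards [Ioc_mem_nhdsGT hs₀] with s hs
    exact Eventually.of_forall fun p =>
      ENNReal.ofReal_le_ofReal (powFun_mono hs.1 hs.2 ENNReal.toReal_nonneg)
  rw [hI] at hR
  obtain ⟨s, hs, hs'⟩ := ((hlim.eventually (gt_mem_nhds hR)).and (Ioc_mem_nhdsGT hs₀)).exists
  refine ⟨s, hs'.1, hs'.2, ?_⟩
  rw [← hid s hs'.1, add_comm]
  gcongr

end MomentLimit

/-! ### Achievability by random coding -/

section Achievability

variable {𝒳 𝒴 : Type*} [MeasurableSpace 𝒳] [DiscreteMeasurableSpace 𝒳]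
    [Countable 𝒳] [MeasurableSpace 𝒴] [DiscreteMeasurableSpace 𝒴] [Countable 𝒴]

lemma ratio_prod {A ι : Type*} [MeasurableSpace A] [Fintype ι] (μ ν : ι → Measure A)
    [∀ i, IsFiniteMeasure (ν i)] (a : ι → A) :
    (∏ i, μ i {a i}) / ∏ i, ν i {a i} = ∏ i, ratio (μ i) (ν i) (a i) := by
  simp only [ratio, div_eq_mul_inv, Finset.prod_mul_distrib]
  rw [ENNReal.prod_inv_distrib]
  intro i _ j _ _
  exact Or.inr (measure_ne_top _ _)

/-- The law of `(X^n, Y^n)` given `W^n = w`. -/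
noncomputable def blockLaw {W : Type*} [MeasurableSpace W] (KX : Kernel W 𝒳) (KY : Kernel W 𝒴)
    (n : ℕ) (w : Fin n → W) : Measure ((Fin n → 𝒳) × (Fin n → 𝒴)) :=
  (Measure.pi fun i => KX (w i)).prod (Measure.pi fun i => KY (w i))

variable {W : Type*} [MeasurableSpace W] (PW : Measure W) [IsProbabilityMeasure PW]
  (KX : Kernel W 𝒳) (KY : Kernel W 𝒴) [IsMarkovKernel KX] [IsMarkovKernel KY]

lemma blockLaw_singleton (n : ℕ) (w : Fin n → W) (x : Fin n → 𝒳) (y : Fin n → 𝒴) :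
    blockLaw KX KY n w {(x, y)} = ∏ i, (KX ×ₖ KY) (w i) {(x i, y i)} := by
  rw [blockLaw, ← Set.singleton_prod_singleton, Measure.prod_prod, Measure.pi_singleton,
    Measure.pi_singleton, ← Finset.prod_mul_distrib]
  refine Finset.prod_congr rfl fun i _ => ?_
  rw [Kernel.prod_apply, ← Set.singleton_prod_singleton, Measure.prod_prod]

lemma measurable_blockLaw (n : ℕ) (z : (Fin n → 𝒳) × (Fin n → 𝒴)) :
    Measurable fun w => blockLaw KX KY n w {z} := by
  obtain ⟨x, y⟩ := z
  simp only [blockLaw_singleton]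
  exact Finset.measurable_fun_prod _ fun i _ =>
    ((KX ×ₖ KY).measurable_coe .of_discrete).comp (measurable_pi_apply i)

/-- The `n`-fold memoryless channel from `W^n` to `(X^n, Y^n)`. -/
noncomputable def blockKernel (n : ℕ) : Kernel (Fin n → W) ((Fin n → 𝒳) × (Fin n → 𝒴)) :=
  kernelOfSingleton (blockLaw KX KY n) (measurable_blockLaw KX KY n)

instance (n : ℕ) : IsMarkovKernel (blockKernel KX KY n) := by
  refine ⟨fun w => ?_⟩
  change IsProbabilityMeasure (blockLaw KX KY n w)
  unfold blockLaw
  infer_instance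

lemma blockKernel_bind (n : ℕ) :
    blockKernel KX KY n ∘ₘ (Measure.pi fun _ : Fin n => PW) = iidLaw ((KX ×ₖ KY) ∘ₘ PW) n := by
  refine Measure.ext_of_singleton ?_
  rintro ⟨x, y⟩
  rw [Measure.bind_apply .of_discrete (Kernel.aemeasurable _), iidLaw_singleton]
  calc ∫⁻ w, blockKernel KX KY n w {(x, y)} ∂(Measure.pi fun _ : Fin n => PW)
      = ∫⁻ w, ∏ i, (KX ×ₖ KY) (w i) {(x i, y i)} ∂(Measure.pi fun _ : Fin n => PW) :=
        lintegral_congr fun w => blockLaw_singleton KX KY n w x y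
    _ = ∏ i, ∫⁻ w, (KX ×ₖ KY) w {(x i, y i)} ∂PW :=
        lintegral_pi_prod PW (fun i w => (KX ×ₖ KY) w {(x i, y i)}) fun i =>
          (KX ×ₖ KY).measurable_coe .of_discrete
    _ = _ := by
        refine Finset.prod_congr rfl fun i _ => ?_
        rw [Measure.bind_apply .of_discrete (Kernel.aemeasurable _)]

/-- The likelihood ratio of the memoryless channel is a product over letters that are independent
under the product of the marginals. -/
lemma infoMoment_block (n : ℕ) {s : ℝ} (hs : 0 < s) :
    infoMoment (Measure.pi fun _ : Fin n => PW) (blockKernel KX KY n) s =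
      infoMoment PW (KX ×ₖ KY) s ^ n := by
  set q := (KX ×ₖ KY) ∘ₘ PW with hq
  have hm : ∀ z, Measurable fun w => ratio ((KX ×ₖ KY) w) q z ^ (1 + s) := fun z =>
    ((measurable_ratio_kernel (KX ×ₖ KY) q).comp measurable_prodMk_right).pow_const _
  rw [infoMoment, blockKernel_bind, ← hq]
  have hr : ∀ (w : Fin n → W) (z : Fin n → 𝒳 × 𝒴),
      ratio (blockKernel KX KY n w) (iidLaw q n) (fun i => (z i).1, fun i => (z i).2) =
        ∏ i, ratio ((KX ×ₖ KY) (w i)) q (z i) := by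
    intro w z
    rw [← ratio_prod, ratio, iidLaw_singleton]
    congr 1
    exact blockLaw_singleton KX KY n w _ _
  rw [iidLaw, lintegral_map .of_discrete .of_discrete, ← iidLaw]
  simp only [hr]
  calc _ = ∫⁻ z, ∏ i, ∫⁻ w, ratio ((KX ×ₖ KY) w) q (z i) ^ (1 + s) ∂PW
        ∂(Measure.pi fun _ : Fin n => q) := by
        refine lintegral_congr fun z => ?_
        rw [← lintegral_pi_prod PW (fun i w => ratio ((KX ×ₖ KY) w) q (z i) ^ (1 + s))
          fun i => hm (z i)]
        refine lintegral_congr fun w => ?_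
        rw [ENNReal.prod_rpow_of_nonneg (by positivity)]
    _ = ∏ _i : Fin n, infoMoment PW (KX ×ₖ KY) s :=
        lintegral_pi_prod q (fun _ z => ∫⁻ w, ratio ((KX ×ₖ KY) w) q z ^ (1 + s) ∂PW)
          fun _ => .of_discrete
    _ = _ := by rw [Finset.prod_const, Finset.card_univ, Fintype.card_fin]

lemma exists_code (n : ℕ) {M : ℕ} (hM : 0 < M) {R : ℝ} (hR : Real.log M / n ≤ R) {s : ℝ}
    (hs : 0 < s) (hs1 : s ≤ 1) : ∃ c : FixedLengthCode 𝒳 𝒴 n R,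
      ENNReal.ofReal s * klDiv c.law (iidLaw ((KX ×ₖ KY) ∘ₘ PW) n) ≤
        (M : ℝ≥0∞)⁻¹ ^ s * infoMoment PW (KX ×ₖ KY) s ^ n := by
  obtain ⟨w, hw⟩ := exists_codebook (Measure.pi fun _ : Fin n => PW) (blockKernel KX KY n) hM hs hs1
  rw [blockKernel_bind, infoMoment_block PW KX KY n hs] at hw
  exact ⟨{ size := M, size_pos := hM, rate_le := hR
           PX := fun m => ⟨Measure.pi fun i => KX (w m i), inferInstance⟩
           PY := fun m => ⟨Measure.pi fun i => KY (w m i), inferInstance⟩ }, hw⟩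

/-- For I < R' < R some s has B(s) ≤ 1 + sR' ≤ exp(sR'). With about exp(nR) codewords the divergence
is then at most a constant times exp(-ns(R - R')). -/
lemma T1_le_info (P : MarkovTriple 𝒳 𝒴) {s₀ : ℝ} (hs₀ : 0 < s₀) (hs₀1 : s₀ ≤ 1)
    (h : ∫⁻ z, P.lawXY {z} ^ (-s₀) ∂P.lawXY ≠ ∞) : T1 P.lawXY ≤ P.info := by
  refine le_of_forall_gt_imp_ge_of_dense fun R hR => ?_
  by_cases hRt : R = ∞
  · rw [hRt]; exact le_top
  obtain ⟨R', hR1, hR2⟩ := exists_between hR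
  lift R to ℝ≥0 using hRt
  lift R' to ℝ≥0 using (hR2.trans ENNReal.coe_lt_top).ne
  have hRR : (R' : ℝ) < R := by exact_mod_cast hR2
  set PW : Measure P.W := (P.PW : Measure P.W)
  have hlaw : (P.PX ×ₖ P.PY) ∘ₘ PW = P.lawXY := P.lawXY_eq.symm
  rw [P.info_eq, P.lawXY_eq] at hR1
  rw [← hlaw] at h
  have hmom := ne_top_of_le_ne_top h (infoMoment_le PW (P.PX ×ₖ P.PY) hs₀)
  obtain ⟨s, hs, hss, hB⟩ := exists_infoMoment_le PW (P.PX ×ₖ P.PY) hs₀ hmom hR1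
  have hs1 := hss.trans hs₀1
  have hB' : infoMoment PW (P.PX ×ₖ P.PY) s ≤ ENNReal.ofReal (Real.exp (s * R')) := by
    refine hB.trans ?_
    rw [← ENNReal.ofReal_coe_nnreal, ← ENNReal.ofReal_mul hs.le, ← ENNReal.ofReal_one,
      ← ENNReal.ofReal_add zero_le_one (by positivity)]
    refine ENNReal.ofReal_le_ofReal ?_
    have := Real.add_one_le_exp (s * (R' : ℝ))
    linarith
  have hM : ∀ n : ℕ, 1 ≤ Real.exp (n * R) := fun n => Real.one_le_exp (by positivity)
  have hMpos : ∀ n : ℕ, 0 < ⌊Real.exp (n * R)⌋₊ := fun n => Nat.floor_pos.2 (hM n)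
  have hrate : ∀ n : ℕ, Real.log (⌊Real.exp (n * R)⌋₊ : ℕ) / n ≤ R := by
    intro n
    rcases n.eq_zero_or_pos with rfl | hn
    · simp
    rw [div_le_iff₀ (by exact_mod_cast hn), Real.log_le_iff_le_exp (by exact_mod_cast hMpos n),
      mul_comm]
    exact Nat.floor_le (Real.exp_pos _).le
  choose c hc using fun n : ℕ => exists_code PW P.PX P.PY n (hMpos n) (hrate n) hs hs1
  refine iInf₂_le R ⟨c, ?_⟩
  rw [hlaw] at hc
  have hbound : ∀ n : ℕ, klDiv (c n).law (iidLaw P.lawXY n) ≤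
      ENNReal.ofReal (s⁻¹ * 2 ^ s * Real.exp (-(s * (R - R'))) ^ n) := by
    intro n
    -- The factor 2 pays for the floor: ⌊x⌋ ≥ x/2 when x ≥ 1.
    have h1 : ((⌊Real.exp (n * R)⌋₊ : ℕ) : ℝ≥0∞)⁻¹ ^ s ≤
        ENNReal.ofReal ((2 * Real.exp (-(n * R))) ^ s) := by
      rw [← ENNReal.ofReal_rpow_of_nonneg (by positivity) hs.le]
      refine ENNReal.rpow_le_rpow ?_ hs.le
      rw [← ENNReal.ofReal_natCast, ← ENNReal.ofReal_inv_of_pos (by exact_mod_cast hMpos n)]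
      refine ENNReal.ofReal_le_ofReal ?_
      rw [Real.exp_neg, ← div_eq_mul_inv, inv_le_comm₀ (by exact_mod_cast hMpos n) (by positivity),
        inv_div]
      have h2 := Nat.lt_floor_add_one (Real.exp (n * R))
      have h3 : (1 : ℝ) ≤ (⌊Real.exp (n * R)⌋₊ : ℕ) := by exact_mod_cast hMpos n
      linarith
    have h4 : ENNReal.ofReal s * klDiv (c n).law (iidLaw P.lawXY n) ≤
        ENNReal.ofReal (2 ^ s * Real.exp (-(s * (R - R'))) ^ n) := by
      refine (hc n).trans ?_
      calc _ ≤ ENNReal.ofReal ((2 * Real.exp (-(n * R))) ^ s) *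
            ENNReal.ofReal (Real.exp (s * R')) ^ n := by gcongr
        _ = _ := by
          rw [← ENNReal.ofReal_pow (Real.exp_pos _).le, ← ENNReal.ofReal_mul (by positivity),
            Real.mul_rpow zero_le_two (Real.exp_pos _).le, ← Real.exp_mul, ← Real.exp_nat_mul,
            ← Real.exp_nat_mul, mul_assoc, ← Real.exp_add]
          congr 3
          ring
    have hs0 : ENNReal.ofReal s ≠ 0 := by simpa using hs
    calc klDiv (c n).law (iidLaw P.lawXY n)
        = ENNReal.ofReal s⁻¹ * (ENNReal.ofReal s * klDiv (c n).law (iidLaw P.lawXY n)) := by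
          rw [← mul_assoc, ← ENNReal.ofReal_mul (by positivity), inv_mul_cancel₀ hs.ne',
            ENNReal.ofReal_one, one_mul]
      _ ≤ ENNReal.ofReal s⁻¹ * ENNReal.ofReal (2 ^ s * Real.exp (-(s * (R - R'))) ^ n) := by gcongr
      _ = _ := by rw [← ENNReal.ofReal_mul (by positivity), mul_assoc]
  refine tendsto_of_tendsto_of_tendsto_of_le_of_le tendsto_const_nhds ?_ (fun _ => zero_le) hbound
  have hexp : Real.exp (-(s * (R - R'))) < 1 := by
    rw [Real.exp_lt_one_iff]
    have := mul_pos hs (sub_pos.2 hRR)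
    linarith
  have := (tendsto_pow_atTop_nhds_zero_of_lt_one (Real.exp_pos _).le hexp).const_mul (s⁻¹ * 2 ^ s)
  simpa using ENNReal.tendsto_ofReal this

lemma T1_le_wynerCI (π : Measure (𝒳 × 𝒴)) {s : ℝ} (hs : 0 < s) (hs1 : s ≤ 1)
    (h : ∫⁻ z, π {z} ^ (-s) ∂π ≠ ∞) : T1 π ≤ wynerCI π := by
  refine le_iInf₂ fun P hP => ?_
  subst hP
  exact T1_le_info P hs hs1 h

end Achievability

/-- Finiteness of a Rényi entropy of order less than one, as a negative moment. -/
lemma exists_lintegral_rpow_neg_ne_top {A : Type*} [MeasurableSpace A] [DiscreteMeasurableSpace A]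
    [Countable A] (π : Measure A) [IsProbabilityMeasure π] {α : ℝ} (hα : α ∈ Set.Ico (0 : ℝ) 1)
    (hH : renyiEntropy α π < ⊤) : ∃ s : ℝ, 0 < s ∧ s ≤ 1 ∧ ∫⁻ z, π {z} ^ (-s) ∂π ≠ ∞ := by
  have h1α : 0 < 1 - α := by linarith [hα.2]
  have hsum : ∑' x : {x : A // π {x} ≠ 0}, π {x.1} ^ α ≠ ∞ := by
    intro h
    rw [renyiEntropy, h, ENNReal.log_top, EReal.coe_mul_top_of_pos (inv_pos.2 h1α)] at hH
    exact lt_irrefl _ hH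
  -- With this s one has 1 - s ≥ α, and π(z) ≤ 1 gives π(z)^(1-s) ≤ π(z)^α on the support.
  refine ⟨(1 - α) / 2, by linarith, by linarith [hα.1], ne_top_of_le_ne_top hsum ?_⟩
  rw [lintegral_countable']
  refine le_trans ?_ (tsum_subtype {x : A | π {x} ≠ 0} fun x => π {x} ^ α).ge
  refine ENNReal.tsum_le_tsum fun z => ?_
  by_cases hz : π {z} = 0
  · simp [hz]
  rw [Set.indicator_of_mem (show z ∈ {x : A | π {x} ≠ 0} from hz)]
  calc π {z} ^ (-((1 - α) / 2)) * π {z} = π {z} ^ (-((1 - α) / 2) + 1) := by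
        rw [ENNReal.rpow_add _ _ hz (measure_ne_top _ _), ENNReal.rpow_one]
    _ ≤ π {z} ^ α := ENNReal.rpow_le_rpow_of_exponent_ge prob_le_one (by linarith)

end CommonInfo

/-! ### The theorem -/

theorem mainTheorem8 {𝒳 𝒴 : Type*}
    [MeasurableSpace 𝒳] [DiscreteMeasurableSpace 𝒳] [Countable 𝒳] [Infinite 𝒳]
    [MeasurableSpace 𝒴] [DiscreteMeasurableSpace 𝒴] [Countable 𝒴] [Infinite 𝒴]
    (π : Measure (𝒳 × 𝒴)) [IsProbabilityMeasure π]
    (α : ℝ) (hα : α ∈ Set.Ico (0 : ℝ) 1) (hH : CommonInfo.renyiEntropy α π < ⊤) :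
    CommonInfo.normalizedT1 π = CommonInfo.T1 π ∧
    CommonInfo.T1 π = CommonInfo.wynerCI π ∧
    Tendsto (CommonInfo.relaxedWynerCI π) (𝓝[>] 0) (𝓝 (CommonInfo.wynerCI π)) ∧
    ∀ (e : 𝒳 ≃ ℤ) (f : 𝒴 ≃ ℤ),
      Tendsto (fun k : ℕ => CommonInfo.wynerCI (CommonInfo.condTrunc e f π k))
        atTop (𝓝 (CommonInfo.wynerCI π)) ∧
      Tendsto (fun k : ℕ => CommonInfo.wynerCI (CommonInfo.mapTrunc e f π k))
        atTop (𝓝 (CommonInfo.wynerCI π)) := by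
  obtain ⟨s, hs, hs1, hfin⟩ := CommonInfo.exists_lintegral_rpow_neg_ne_top π hα hH
  have hent := CommonInfo.lintegral_selfInfo_ne_top π hs hfin
  -- The relaxed limit involves no labelling, but its proof exhausts the alphabets by finite boxes;
  -- any labelling will do.
  obtain ⟨e₀⟩ := nonempty_equiv_of_countable (α := 𝒳) (β := ℤ)
  obtain ⟨f₀⟩ := nonempty_equiv_of_countable (α := 𝒴) (β := ℤ)
  have hrel := CommonInfo.tendsto_relaxedWynerCI e₀ f₀ π hent
  have h1 := CommonInfo.wynerCI_le_normalizedT1 π hrel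
  have h2 := CommonInfo.normalizedT1_le_T1 π
  have h3 := CommonInfo.T1_le_wynerCI π hs hs1 hfin
  exact ⟨le_antisymm h2 (h3.trans h1), le_antisymm h3 (h1.trans h2), hrel, fun e f =>
    ⟨CommonInfo.tendsto_wynerCI_condTrunc e f π hent,
      CommonInfo.tendsto_wynerCI_mapTrunc e f π hent⟩⟩
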